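/- Let $n\in\mathbb N$, $\alpha,\beta,\kappa\in\mathbb C$ and ${\bf c}=(c_1,\dots,c_{n-1})\in\mathbb C^{n-1}$ with ${\bf c}\ne 0$ (so $n\ge 2$). Let $T=T_n(\alpha,\beta;{\bf c},{\bf d})\in M_n(\mathbb C)$ be the tridiagonal matrix with main diagonal $(\alpha,\beta,\alpha,\beta,\dots)$, first lower subdiagonal ${\bf c}$ and first upper subdiagonal ${\bf d}=\kappa\,\overline{\bf c}$, and let $\tilde J=\mathrm{diag}(1,-1,1,-1,\dots)\in M_n$. *Krein space notions.* For $J=\tilde J$ put $[x,y]_J=y^*Jx$ and $A^{\#}=JA^*J$. The $J$-numerical range of $A\in M_n$ is $W^J(A)=-W^J_-(A)\cup W^J_+(A)$, where $W^J_\pm(A)=\{[Ax,x]_J:\ x\in\mathbb C^n,\ [x,x]_J=\pm1\}$. With $\Re^J(A)=\frac{A+A^{\#}}2$ and $\Im^J(A)=\frac{A-A^{\#}}{2i}$, the indefinite Kippenhahn curve $C^J(A)\subset\mathbb R^2=\mathbb C$ is the set of real affine points of the algebraic curve given in homogeneous line coordinates $(u:v:w)$ by $\det\big(u\,\Re^J(A)+v\,\Im^J(A)+w\,I_n\big)=0$,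 that is, of the union of the dual curves of the irreducible components of this equation; a linear component $x_0u+y_0v+w$ contributes the point $(x_0,y_0)$. *Data.* Let $\omega=\frac12(\alpha-\beta)$. Let $X({\bf c})$ be the $\lceil\frac n2\rceil\times\lfloor\frac n2\rfloor$ lower bidiagonal matrix with diagonal $c_1,c_3,c_5,\dots$ and subdiagonal $c_2,c_4,\dots$, let $s_1\ge\dots\ge s_{\lfloor n/2\rfloor}$ be its singular values and $k$ its rank. For $j=1,\dots,k$ let $\mathcal H_j$ be the hyperbola with foci $$\tfrac12(\alpha+\beta)\pm\sqrt{\omega^2+\kappa s_j^2}$$ and non-transverse axis of (full) length $$\sqrt{2\,|\omega^2+\kappa s_j^2|-2|\omega|^2+(|\kappa|^2+1)\,s_j^2}\,.$$ These data define a (non-degenerate) hyperbola if and only if this length is positive and smaller than the distance of the two foci. Its closed hyperbolic disc is the union of the two closed convex regions, containing the foci, that are bounded by its two branches. The hyperbolas are called nested if the closed disc of $\mathcal H_j$ is contained in that of $\mathcal H_i$ whenever $i\le j$. *Claim.* The following are equivalent: (a) $\mathcal H_1,\dots,\mathcal H_k$ are non-degenerate nested hyperbolas and $C^{\tilde J}(T)=\mathcal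 H_1\cup\dots\cup\mathcal H_k\cup P$, where $P=\{\alpha,\beta\}$ if $k<\lfloor\frac n2\rfloor$, $P=\{\alpha\}$ if $k=\lfloor\frac n2\rfloor$ and $n$ is odd, and $P=\emptyset$ if $k=\frac n2$; (b) $$\Big|\,|\omega|^2-\frac{|\kappa|^2+1}{2}\,s_1^2\Big|<\big|\omega^2+\kappa s_1^2\big|.$$ In this case $W^{\tilde J}(T)$ is bounded by the non-degenerate hyperbola $\mathcal H_1$: it is equal to the closed hyperbolic disc of $\mathcal H_1$, and its boundary is $\mathcal H_1$. -/

import Mathlib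

open scoped Matrix

noncomputable section

/-! ### Krein space notions for a matrix `J` with `J² = 1`, `J = Jᴴ` -/

/-- The indefinite inner product `[x, y]_J = y^* J x`. -/
def kreinInner {n : ℕ} (J : Matrix (Fin n) (Fin n) ℂ) (x y : Fin n → ℂ) : ℂ :=
  star y ⬝ᵥ (J *ᵥ x)

/-- `W_+^J(A)`. -/
def kreinRangePos {n : ℕ} (J A : Matrix (Fin n) (Fin n) ℂ) : Set ℂ :=
  {w | ∃ x : Fin n → ℂ, kreinInner J x x = 1 ∧ kreinInner J (A *ᵥ x) x = w}

/-- `W_-^J(A)`. -/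
def kreinRangeNeg {n : ℕ} (J A : Matrix (Fin n) (Fin n) ℂ) : Set ℂ :=
  {w | ∃ x : Fin n → ℂ, kreinInner J x x = -1 ∧ kreinInner J (A *ᵥ x) x = w}

/-- The Krein space numerical range `W^J(A) = -W_-^J(A) ∪ W_+^J(A)`. -/
def kreinRange {n : ℕ} (J A : Matrix (Fin n) (Fin n) ℂ) : Set ℂ :=
  {w | -w ∈ kreinRangeNeg J A} ∪ kreinRangePos J A

/-- The `J`-adjoint `A^# = J A^* J`. -/
def kreinAdjoint {n : ℕ} (J A : Matrix (Fin n) (Fin n) ℂ) : Matrix (Fin n) (Fin n) ℂ :=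
  J * Aᴴ * J

/-- `Re^J(A) = (A + A^#) / 2`. -/
def kreinRe {n : ℕ} (J A : Matrix (Fin n) (Fin n) ℂ) : Matrix (Fin n) (Fin n) ℂ :=
  (1 / 2 : ℂ) • (A + kreinAdjoint J A)

/-- `Im^J(A) = (A - A^#) / (2i)`. -/
def kreinIm {n : ℕ} (J A : Matrix (Fin n) (Fin n) ℂ) : Matrix (Fin n) (Fin n) ℂ :=
  (1 / (2 * Complex.I)) • (A - kreinAdjoint J A)

/-- The form `det (u Re^J(A) + v Im^J(A) + w I)` in the homogeneous line coordinates
`u = X 0`, `v = X 1`, `w = X 2`. -/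
def kreinForm {n : ℕ} (J A : Matrix (Fin n) (Fin n) ℂ) : MvPolynomial (Fin 3) ℂ :=
  Matrix.det ((MvPolynomial.X 0 : MvPolynomial (Fin 3) ℂ) • (kreinRe J A).map MvPolynomial.C +
    (MvPolynomial.X 1 : MvPolynomial (Fin 3) ℂ) • (kreinIm J A).map MvPolynomial.C +
    (MvPolynomial.X 2 : MvPolynomial (Fin 3) ℂ) • (1 : Matrix (Fin n) (Fin n) (MvPolynomial (Fin 3) ℂ)))

/-- The affine part of the curve in the point plane whose equation in line coordinates is `F = 0`:
the closure of the set of the points `(x, y) = (x : y : 1)` at which the lines `(u : v : w)` that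
are nonsingular points of an irreducible component `p = 0` of `F = 0` touch their envelope. The
point of contact is the gradient of `p` at `(u, v, w)`. A linear component
`x₀ u + y₀ v + w` gives the single point `(x₀, y₀)`. -/
def dualCurve (F : MvPolynomial (Fin 3) ℂ) : Set (ℂ × ℂ) :=
  closure {P | ∃ p : MvPolynomial (Fin 3) ℂ, Irreducible p ∧ p ∣ F ∧
    ∃ l : Fin 3 → ℂ, l ≠ 0 ∧ MvPolynomial.eval l p = 0 ∧
      ∃ t : ℂ, t ≠ 0 ∧
        MvPolynomial.eval l (MvPolynomial.pderiv 0 p) = t * P.1 ∧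
        MvPolynomial.eval l (MvPolynomial.pderiv 1 p) = t * P.2 ∧
        MvPolynomial.eval l (MvPolynomial.pderiv 2 p) = t}

/-- The indefinite Kippenhahn curve (boundary generating curve) `C^J(A)`: the real points of the
curve given in line coordinates by `det (u Re^J(A) + v Im^J(A) + w I) = 0`, the real plane being
identified with `ℂ`. -/
def kreinCurve {n : ℕ} (J A : Matrix (Fin n) (Fin n) ℂ) : Set ℂ :=
  {z | ((z.re : ℂ), (z.im : ℂ)) ∈ dualCurve (kreinForm J A)}

/-! ### Hyperbolas given by foci and non-transverse axis -/

/-- The foci `f₁, f₂` and the length `b` of the (full) non-transverse axis belong to a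
non-degenerate hyperbola; its transverse axis then has length `√(|f₁ - f₂|² - b²) > 0`. -/
def IsHyperbolaData (f₁ f₂ : ℂ) (b : ℝ) : Prop :=
  0 < b ∧ b < dist f₁ f₂

/-- The hyperbola (both branches) with foci `f₁, f₂` and non-transverse axis of length `b`. -/
def hyperbola (f₁ f₂ : ℂ) (b : ℝ) : Set ℂ :=
  {z | |dist z f₁ - dist z f₂| = Real.sqrt (dist f₁ f₂ ^ 2 - b ^ 2)}

/-- The closed hyperbolic disc: the two closed convex regions, containing the foci, that are
bounded by the two branches of the hyperbola. -/
def hyperbolicDisc (f₁ f₂ : ℂ) (b : ℝ) : Set ℂ :=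
  {z | Real.sqrt (dist f₁ f₂ ^ 2 - b ^ 2) ≤ |dist z f₁ - dist z f₂|}

/-! ### The tridiagonal matrices (indices start at `0`, so `c_j` is `c (j - 1)`) -/

/-- `J̃ = diag (1, -1, 1, -1, …)`. -/
def altSign (n : ℕ) : Matrix (Fin n) (Fin n) ℂ :=
  Matrix.diagonal fun i => (-1) ^ (i : ℕ)

/-- `T_n(α, β; c, d)`: main diagonal `(α, β, α, β, …)`, first lower subdiagonal `c`, first upper
subdiagonal `d`. -/
def biperiodicTridiag (n : ℕ) (α β : ℂ) (c d : Fin (n - 1) → ℂ) : Matrix (Fin n) (Fin n) ℂ :=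
  Matrix.of fun i j =>
    if i = j then (if Even (i : ℕ) then α else β)
    else if h : (i : ℕ) = j + 1 then c ⟨j, by omega⟩
    else if h : (j : ℕ) = i + 1 then d ⟨i, by omega⟩
    else 0

/-- The bidiagonal matrix `X(c)`, of size `⌈n/2⌉ × ⌊n/2⌋`, with diagonal `c_1, c_3, c_5, …` and
subdiagonal `c_2, c_4, …`. -/
def bidiag (n : ℕ) (c : Fin (n - 1) → ℂ) : Matrix (Fin ((n + 1) / 2)) (Fin (n / 2)) ℂ :=
  Matrix.of fun i j =>
    if h : (i : ℕ) = j then c ⟨2 * j, by omega⟩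
    else if h : (i : ℕ) = j + 1 then c ⟨2 * j + 1, by omega⟩
    else 0

/-- The singular values of `X(c)` in decreasing order; `bidiagSing n c j` is `s_{j+1}`. -/
def bidiagSing (n : ℕ) (c : Fin (n - 1) → ℂ) (j : ℕ) : ℝ :=
  (Matrix.toEuclideanLin (bidiag n c)).singularValues j

/-- The focus `(α + β)/2 + √(ω² + κ s²)`, `ω = (α - β)/2`. -/
def focusPlus (α β κ : ℂ) (s : ℝ) : ℂ :=
  (α + β) / 2 + (((α - β) / 2) ^ 2 + κ * (s : ℂ) ^ 2) ^ (1 / 2 : ℂ)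

/-- The focus `(α + β)/2 - √(ω² + κ s²)`, `ω = (α - β)/2`. -/
def focusMinus (α β κ : ℂ) (s : ℝ) : ℂ :=
  (α + β) / 2 - (((α - β) / 2) ^ 2 + κ * (s : ℂ) ^ 2) ^ (1 / 2 : ℂ)

/-- The length `√(2|ω² + κ s²| - 2|ω|² + (|κ|² + 1) s²)` of the non-transverse axis. -/
def nonTransverseAxis (α β κ : ℂ) (s : ℝ) : ℝ :=
  Real.sqrt (2 * ‖((α - β) / 2) ^ 2 + κ * (s : ℂ) ^ 2‖ - 2 * ‖(α - β) / 2‖ ^ 2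
    + (‖κ‖ ^ 2 + 1) * s ^ 2)

/-- The points that `C^J(T)` contains besides the hyperbolas, in terms of `n` and of the rank `k`
of `X(c)`. -/
def exceptionalPoints (n k : ℕ) (α β : ℂ) : Set ℂ :=
  if k < n / 2 then {α, β} else if Odd n then {α} else ∅

end

/-!
The key observation is that both the range and the curve depend on `T` only through `n`, `α`, `β`,
`κ` and the singular values of `X(c)`.

*Range.* Let `E`, `O` be the squared norms of the even and odd parts of a vector `x`, and
`S = ∑ (-1)^j c_j x_j conj x_{j+1}`. Then `[x, x] = E - O` and
`[Tx, x] = α E - β O + κ conj S - S`. Since the underlying graph is a path, the phases of the terms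
of `S` can be chosen freely, so that `|S| ≤ s₁ √(E O)` always holds, and every `S` with
`|S| = s₁ √(E O)` occurs (`sum_norm_mul_le`, `exists_sum_norm_mul_eq`). Normalizing `E - O = ± 1`,
the range lies between the images of the two-sheeted hyperboloid `t² - |y|² = 1` and of the solid
`t² - |y|² ≥ 1` under a real linear map `ℝ × ℂ → ℂ`, translated to `(α + β) / 2`
(`hyperboloidImage`). The strict inequality `| |ω|² - (|κ|² + 1) s₁² / 2 | < |ω² + κ s₁²|` says
that the kernel of this map is spacelike, and then both images are the closed hyperbolic disc of
`ℋ₁` (`hypForm_ge_of_hyperboloid`,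
`exists_hyperboloid_of_hypForm_ge`). The same description, with `s_j` in place of `s₁`, applies to
all the hyperbolas. It makes nestedness obvious (`hyperboloidImage_mono`), while
`norm_focalSq_sq_sub` shows that the inequality is inherited by smaller `s > 0`.

*Curve.* The pencil `u Re^J(T) + v Im^J(T) + w` is tridiagonal with alternating diagonal entries
`a`, `b`, and the products of its symmetric off-diagonal entries are `|c_j|² q` with a common
quadratic form `q`. Determinants of tridiagonal matrices depend on such products only, so `q` can be
moved to one side, and a Schur complement gives
`det = a ^ (⌈n/2⌉ - ⌊n/2⌋) ∏ (a b - q s_j²)` (`kreinForm_biperiodicTridiag`). Each factor is the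
equation of `ℋ_j` in line coordinates, or `a b`, the pair of points `α`, `β`, if `s_j = 0`. Contact
points are compared directly between a polynomial and its irreducible factors, so that
irreducibility of the conics is not needed (`dualCurve_mul_prod`).
-/

open scoped ComplexConjugate

/-! ### Tridiagonal matrices -/

/-- The entries of the infinite tridiagonal matrix with diagonal `d`, lower subdiagonal `l` and
upper subdiagonal `u`. -/
def triEntry {R : Type*} [Zero R] (d l u : ℕ → R) (i j : ℕ) : R :=
  if i = j then d i else if i = j + 1 then l j else if j = i + 1 then u i else 0

/-- The `n × n` tridiagonal matrix with diagonal `d`, lower subdiagonal `l` and upper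
subdiagonal `u`, all three given as sequences indexed by `ℕ`. -/
def triMat {R : Type*} [Zero R] (d l u : ℕ → R) (n : ℕ) : Matrix (Fin n) (Fin n) R :=
  Matrix.of fun i j => triEntry d l u i j

theorem triMat_apply {R : Type*} [Zero R] (d l u : ℕ → R) (n : ℕ) (i j : Fin n) :
    triMat d l u n i j = triEntry d l u i j := rfl

@[simp] theorem triEntry_diag {R : Type*} [Zero R] (d l u : ℕ → R) (i : ℕ) :
    triEntry d l u i i = d i := by simp [triEntry]

@[simp] theorem triEntry_lower {R : Type*} [Zero R] (d l u : ℕ → R) (i : ℕ) :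
    triEntry d l u (i + 1) i = l i := by simp [triEntry]

@[simp] theorem triEntry_upper {R : Type*} [Zero R] (d l u : ℕ → R) (i : ℕ) :
    triEntry d l u i (i + 1) = u i := by
  rw [triEntry, if_neg (by omega), if_neg (by omega), if_pos rfl]

theorem triEntry_eq_zero {R : Type*} [Zero R] (d l u : ℕ → R) {i j : ℕ}
    (h : i + 1 < j ∨ j + 1 < i) : triEntry d l u i j = 0 := by
  rw [triEntry, if_neg (by omega), if_neg (by omega), if_neg (by omega)]

/-- The three-term recurrence of continuants. -/
theorem det_triMat_add_two {R : Type*} [CommRing R] (d l u : ℕ → R) (n : ℕ) :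
    (triMat d l u (n + 2)).det =
      d 0 * (triMat (fun i => d (i + 1)) (fun i => l (i + 1)) (fun i => u (i + 1)) (n + 1)).det -
      l 0 * u 0 *
        (triMat (fun i => d (i + 2)) (fun i => l (i + 2)) (fun i => u (i + 2)) n).det := by
  rw [Matrix.det_succ_row_zero, Fin.sum_univ_succ, Fin.sum_univ_succ, Finset.sum_eq_zero]
  · have h1 : (triMat d l u (n + 2)).submatrix Fin.succ (Fin.succAbove 0) =
        triMat (fun i => d (i + 1)) (fun i => l (i + 1)) (fun i => u (i + 1)) (n + 1) := by
      ext i j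
      simp [triMat_apply, triEntry]
    have h2 : ((triMat d l u (n + 2)).submatrix Fin.succ
        (Fin.succAbove (Fin.succ 0 : Fin (n + 2)))).det = l 0 *
        (triMat (fun i => d (i + 2)) (fun i => l (i + 2)) (fun i => u (i + 2)) n).det := by
      rw [Matrix.det_succ_column_zero, Fin.sum_univ_succ, Finset.sum_eq_zero]
      · have h3 : (((triMat d l u (n + 2)).submatrix Fin.succ
            (Fin.succAbove (Fin.succ 0 : Fin (n + 2)))).submatrix (Fin.succAbove 0) Fin.succ) =
            triMat (fun i => d (i + 2)) (fun i => l (i + 2)) (fun i => u (i + 2)) n := by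
          ext i j
          have hj : (Fin.succAbove (1 : Fin (n + 2)) j.succ) = j.succ.succ := by
            simp
          simp [triMat_apply, triEntry, hj]
        rw [h3]
        simp [triMat_apply, triEntry]
      · intro i _
        simp [triMat_apply, triEntry]
    rw [h1, h2]
    simp [triMat_apply, triEntry]
    ring
  · intro i _
    simp [triMat_apply, triEntry]

/-- The determinant of a tridiagonal matrix depends on the off-diagonal entries only through the
products of entries in symmetric position. -/
theorem det_triMat_congr {R : Type*} [CommRing R] (n : ℕ) :
    ∀ (d l u l' u' : ℕ → R), (∀ i, l i * u i = l' i * u' i) →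
      (triMat d l u n).det = (triMat d l' u' n).det := by
  induction n using Nat.twoStepInduction with
  | zero => intros; simp
  | one => intros; simp [triMat_apply, triEntry]
  | more n h0 h1 =>
    intro d l u l' u' h
    rw [det_triMat_add_two, det_triMat_add_two, h 0,
      h0 _ _ _ (fun i => l' (i + 2)) (fun i => u' (i + 2)) fun i => h (i + 2),
      h1 _ _ _ (fun i => l' (i + 1)) (fun i => u' (i + 1)) fun i => h (i + 1)]

/-- The bilinear form of a tridiagonal matrix, at vectors given as sequences indexed by `ℕ`. -/
theorem dotProduct_triMat_mulVec {R : Type*} [CommRing R] (d l u x y : ℕ → R) (n : ℕ) :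
    (fun i : Fin n => y i) ⬝ᵥ (triMat d l u n *ᵥ fun i : Fin n => x i) =
      ∑ i ∈ Finset.range n, d i * (y i * x i) +
      ∑ i ∈ Finset.range (n - 1), (l i * (y (i + 1) * x i) + u i * (y i * x (i + 1))) := by
  have key : (fun i : Fin n => y i) ⬝ᵥ (triMat d l u n *ᵥ fun i : Fin n => x i) =
      ∑ i ∈ Finset.range n, ∑ j ∈ Finset.range n, y i * (triEntry d l u i j * x j) := by
    simp only [dotProduct, Matrix.mulVec, triMat_apply, Finset.mul_sum]
    rw [Finset.sum_range]
    refine Finset.sum_congr rfl fun i _ => ?_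
    rw [Finset.sum_range]
  rw [key]
  clear key
  induction n with
  | zero => simp
  | succ n ih =>
    have hcol : ∑ i ∈ Finset.range n, y i * (triEntry d l u i n * x n) =
        if n = 0 then 0 else u (n - 1) * (y (n - 1) * x n) := by
      rcases n with _ | n
      · simp
      · rw [Finset.sum_range_succ, Finset.sum_eq_zero]
        · simp; ring
        · intro i hi
          have := Finset.mem_range.mp hi
          rw [triEntry_eq_zero _ _ _ (by omega)]; simp
    have hrow : ∑ j ∈ Finset.range n, y n * (triEntry d l u n j * x j) =
        if n = 0 then 0 else l (n - 1) * (y n * x (n - 1)) := by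
      rcases n with _ | n
      · simp
      · rw [Finset.sum_range_succ, Finset.sum_eq_zero]
        · simp; ring
        · intro i hi
          have := Finset.mem_range.mp hi
          rw [triEntry_eq_zero _ _ _ (by omega)]; simp
    rw [Finset.sum_range_succ, Finset.sum_congr rfl (fun i _ => Finset.sum_range_succ _ n),
      Finset.sum_add_distrib, ih, Finset.sum_range_succ, Finset.sum_range_succ _ n, hcol, hrow,
      triEntry_diag]
    rcases n with _ | n
    · simp; ring
    · simp [Finset.sum_range_succ]; ring

/-- The splitting of the indices `0, …, n - 1` into the even ones (left) and the odd ones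
(right). -/
def evenOdd (n : ℕ) : Fin ((n + 1) / 2) ⊕ Fin (n / 2) ≃ Fin n where
  toFun := Sum.elim (fun a => ⟨2 * a, by omega⟩) (fun b => ⟨2 * b + 1, by omega⟩)
  invFun i := if h : (i : ℕ) % 2 = 0 then Sum.inl ⟨i / 2, by omega⟩
    else Sum.inr ⟨i / 2, by omega⟩
  left_inv := by
    rintro (a | b)
    · simp
    · refine (dif_neg ?_).trans ?_
      · simp only [Sum.elim_inr]; omega
      · simp only [Sum.elim_inr, Sum.inr.injEq, Fin.ext_iff]; omega
  right_inv := by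
    intro i
    by_cases h : (i : ℕ) % 2 = 0
    · simp only [h, dite_true, Sum.elim_inl]; ext; simp only; omega
    · simp only [h, dite_false, Sum.elim_inr]; ext; simp only; omega

@[simp] theorem evenOdd_inl (n : ℕ) (a : Fin ((n + 1) / 2)) :
    ((evenOdd n (Sum.inl a) : Fin n) : ℕ) = 2 * a := rfl

@[simp] theorem evenOdd_inr (n : ℕ) (b : Fin (n / 2)) :
    ((evenOdd n (Sum.inr b) : Fin n) : ℕ) = 2 * b + 1 := rfl

/-- The parameters `c_1, …, c_{n-1}` continued by zero to a sequence. -/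
def extendZero {n : ℕ} (c : Fin (n - 1) → ℂ) (j : ℕ) : ℂ :=
  if h : j < n - 1 then c ⟨j, h⟩ else 0

theorem extendZero_of_lt {n : ℕ} (c : Fin (n - 1) → ℂ) {j : ℕ} (h : j < n - 1) :
    extendZero c j = c ⟨j, h⟩ := dif_pos h

theorem bidiag_apply (n : ℕ) (c : Fin (n - 1) → ℂ) (a : Fin ((n + 1) / 2)) (b : Fin (n / 2)) :
    bidiag n c a b = if (a : ℕ) = b then extendZero c (2 * b)
      else if (a : ℕ) = b + 1 then extendZero c (2 * b + 1) else 0 := by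
  simp only [bidiag, Matrix.of_apply]
  split_ifs with h1 h2
  · rw [extendZero_of_lt]
  · rw [extendZero_of_lt]
  · rfl

theorem biperiodicTridiag_eq_triMat (n : ℕ) (α β : ℂ) (c d : Fin (n - 1) → ℂ) :
    biperiodicTridiag n α β c d =
      triMat (fun i => if Even i then α else β) (extendZero c) (extendZero d) n := by
  ext i j
  simp only [biperiodicTridiag, Matrix.of_apply, triMat_apply, Fin.ext_iff, triEntry]
  split_ifs with h1 h2 h3 h4
  · rfl
  · rfl
  · rw [extendZero_of_lt]
  · rw [extendZero_of_lt]
  · rfl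

/-- A tridiagonal matrix whose diagonal alternates between `a` and `b`, and whose off-diagonal
entries are those of the bidiagonal matrix `X(c)` and of `q X(c)^*`, in block form with respect to
the splitting into even and odd indices. -/
theorem triMat_submatrix_evenOdd {R : Type*} [CommRing R] (f : ℂ →+* R) (n : ℕ)
    (c : Fin (n - 1) → ℂ) (a b q : R) :
    (triMat (fun i => if Even i then a else b)
      (fun j => if Even j then q * f (star (extendZero c j)) else f (extendZero c j))
      (fun j => if Even j then f (extendZero c j) else q * f (star (extendZero c j)))
      n).submatrix (evenOdd n) (evenOdd n) =
    Matrix.fromBlocks (a • 1) ((bidiag n c).map f) (q • ((bidiag n c)ᴴ).map f) (b • 1) := by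
  ext (i | i) (j | j)
  · simp only [Matrix.submatrix_apply, triMat_apply, evenOdd_inl, Matrix.fromBlocks_apply₁₁,
      Matrix.smul_apply, Matrix.one_apply, Fin.ext_iff]
    simp only [triEntry]
    by_cases h : (i : ℕ) = j
    · simp [h]
    · rw [if_neg (by omega), if_neg (by omega), if_neg (by omega)]; simp [h]
  · simp only [Matrix.submatrix_apply, triMat_apply, evenOdd_inl, evenOdd_inr,
      Matrix.fromBlocks_apply₁₂, Matrix.map_apply, bidiag_apply]
    simp only [triEntry]
    rw [if_neg (by omega)]
    by_cases h : (i : ℕ) = j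
    · rw [if_neg (by omega), if_pos (by omega), if_pos (by simp), if_pos h, h]
    · by_cases h' : (i : ℕ) = j + 1
      · rw [if_pos (by omega), if_neg (by simp), if_neg h, if_pos h']
      · rw [if_neg (by omega), if_neg (by omega), if_neg h, if_neg h', map_zero]
  · simp only [Matrix.submatrix_apply, triMat_apply, evenOdd_inl, evenOdd_inr,
      Matrix.fromBlocks_apply₂₁, Matrix.map_apply, Matrix.smul_apply, Matrix.conjTranspose_apply,
      bidiag_apply, smul_eq_mul]
    simp only [triEntry]
    rw [if_neg (by omega)]
    by_cases h : (j : ℕ) = i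
    · rw [if_pos (by omega), if_pos (by simp), if_pos h, h]
    · by_cases h' : (j : ℕ) = i + 1
      · rw [if_neg (by omega), if_pos (by omega), if_neg (by simp), if_neg h, if_pos h']
      · rw [if_neg (by omega), if_neg (by omega), if_neg h, if_neg h']; simp
  · simp only [Matrix.submatrix_apply, triMat_apply, evenOdd_inr, Matrix.fromBlocks_apply₂₂,
      Matrix.smul_apply, Matrix.one_apply, Fin.ext_iff]
    simp only [triEntry]
    by_cases h : (i : ℕ) = j
    · simp [h]
    · rw [if_neg (by omega), if_neg (by omega), if_neg (by omega)]; simp [h]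

/-- A Schur complement formula for a scalar block `a`, which need not be invertible: `a ≠ 0` in a
domain is enough to cancel the powers of `a` that clear the denominators. -/
theorem det_fromBlocks_smul_one {R : Type*} [CommRing R] [IsDomain R] {m k : ℕ} (hkm : k ≤ m)
    (a b : R) (ha : a ≠ 0) (X : Matrix (Fin m) (Fin k) R) (Y : Matrix (Fin k) (Fin m) R) :
    (Matrix.fromBlocks (a • 1) X Y (b • 1)).det =
      a ^ (m - k) * ((a * b) • (1 : Matrix (Fin k) (Fin k) R) - Y * X).det := by
  have h : Matrix.fromBlocks (a • 1) X Y (b • 1) *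
      Matrix.fromBlocks (1 : Matrix (Fin m) (Fin m) R) (-X) 0
        (a • (1 : Matrix (Fin k) (Fin k) R)) =
      Matrix.fromBlocks (a • 1) 0 Y ((a * b) • (1 : Matrix (Fin k) (Fin k) R) - Y * X) := by
    rw [Matrix.fromBlocks_multiply]
    congr 1 <;> simp [smul_smul]
    rw [mul_comm a b]; abel
  have h' := congrArg Matrix.det h
  rw [Matrix.det_mul, Matrix.det_fromBlocks_zero₂₁, Matrix.det_fromBlocks_zero₁₂] at h'
  simp only [Matrix.det_one, one_mul, Matrix.det_smul, mul_one, Fintype.card_fin] at h'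
  refine mul_right_cancel₀ (pow_ne_zero k ha) ?_
  rw [h']
  nth_rw 1 [← Nat.sub_add_cancel hkm]
  rw [pow_add]; ring

/-! ### Singular values -/

/-- The characteristic polynomial of `XᴴX`, homogenized: its roots are the squares of the singular
values of `X`. -/
theorem det_smul_one_sub_smul_conjTranspose_mul_self {m k : ℕ} (X : Matrix (Fin m) (Fin k) ℂ)
    (p q : ℂ) :
    (p • (1 : Matrix (Fin k) (Fin k) ℂ) - q • (Xᴴ * X)).det =
      ∏ j ∈ Finset.range k,
        (p - q * (((Matrix.toEuclideanLin X).singularValues j : ℝ) : ℂ) ^ 2) := by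
  have hfin : Module.finrank ℂ (EuclideanSpace ℂ (Fin k)) = k := finrank_euclideanSpace_fin
  have hlin : (Matrix.toEuclideanLin X).adjoint ∘ₗ Matrix.toEuclideanLin X =
      Matrix.toEuclideanLin (Xᴴ * X) := by
    rw [← Matrix.toEuclideanLin_conjTranspose_eq_adjoint]
    ext v i
    simp [Matrix.toLpLin_apply]
  have hchar : (Xᴴ * X).charpoly = ∏ j : Fin k, (Polynomial.X - Polynomial.C
      ((((Matrix.toEuclideanLin X).singularValues j : ℝ) : ℂ) ^ 2)) := by
    have h := ((Matrix.toEuclideanLin X).isSymmetric_adjoint_comp_self).charpoly_eq hfin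
    have h' : ((Matrix.toEuclideanLin X).adjoint ∘ₗ Matrix.toEuclideanLin X).charpoly =
        (Xᴴ * X).charpoly := by
      rw [hlin, Matrix.toEuclideanLin_eq_toLin_orthonormal, Matrix.charpoly_toLin]
    rw [← h', h]
    refine Finset.prod_congr rfl fun j _ => ?_
    rw [← LinearMap.sq_singularValues_fin _ hfin j]
    simp
  rw [Finset.prod_range]
  by_cases hq : q = 0
  · simp [hq]
  · have h : p • (1 : Matrix (Fin k) (Fin k) ℂ) - q • (Xᴴ * X) =
        q • (Matrix.scalar (Fin k) (p / q) - Xᴴ * X) := by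
      rw [smul_sub, Matrix.scalar_apply, ← Matrix.smul_one_eq_diagonal, smul_smul,
        mul_div_cancel₀ _ hq]
    rw [h, Matrix.det_smul, ← Matrix.eval_charpoly, hchar, Polynomial.eval_prod, Fintype.card_fin]
    rw [← Fin.prod_const, ← Finset.prod_mul_distrib]
    refine Finset.prod_congr rfl fun j _ => ?_
    simp only [Polynomial.eval_sub, Polynomial.eval_X, Polynomial.eval_C]
    field_simp

theorem norm_sq_apply_eq_sum_singularValues {m k : ℕ}
    (L : EuclideanSpace ℂ (Fin k) →ₗ[ℂ] EuclideanSpace ℂ (Fin m))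
    (v : EuclideanSpace ℂ (Fin k)) :
    ‖L v‖ ^ 2 = ∑ j : Fin k, L.singularValues j ^ 2 *
      ‖(L.isSymmetric_adjoint_comp_self.eigenvectorBasis
        finrank_euclideanSpace_fin).repr v j‖ ^ 2 := by
  set hT := L.isSymmetric_adjoint_comp_self
  set b := hT.eigenvectorBasis finrank_euclideanSpace_fin
  have h1 : ((‖L v‖ ^ 2 : ℝ) : ℂ) = inner ℂ v ((L.adjoint ∘ₗ L) v) := by
    rw [LinearMap.comp_apply, LinearMap.adjoint_inner_right, inner_self_eq_norm_sq_to_K]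
    simp
  have h2 : inner ℂ v ((L.adjoint ∘ₗ L) v) =
      ((∑ j : Fin k, L.singularValues j ^ 2 * ‖b.repr v j‖ ^ 2 : ℝ) : ℂ) := by
    rw [← b.repr.inner_map_map, PiLp.inner_apply]
    push_cast
    refine Finset.sum_congr rfl fun j _ => ?_
    have h3 := hT.eigenvectorBasis_apply_self_apply finrank_euclideanSpace_fin v j
    rw [LinearMap.coe_comp] at h3
    rw [h3, ← LinearMap.sq_singularValues_fin]
    rw [RCLike.inner_apply, mul_assoc, RCLike.mul_conj]
    simp [b]
  exact_mod_cast h1.trans h2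

/-- The operator norm bound by the greatest singular value. -/
theorem norm_apply_le_singularValues_zero {m k : ℕ}
    (L : EuclideanSpace ℂ (Fin k) →ₗ[ℂ] EuclideanSpace ℂ (Fin m))
    (v : EuclideanSpace ℂ (Fin k)) : ‖L v‖ ≤ L.singularValues 0 * ‖v‖ := by
  refine le_of_sq_le_sq ?_ (mul_nonneg (L.singularValues_nonneg 0) (norm_nonneg v))
  rw [norm_sq_apply_eq_sum_singularValues, mul_pow,
    ← (L.isSymmetric_adjoint_comp_self.eigenvectorBasis finrank_euclideanSpace_fin).repr.norm_map v,
    EuclideanSpace.norm_sq_eq, Finset.mul_sum]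
  refine Finset.sum_le_sum fun j _ => ?_
  gcongr
  · exact L.singularValues_nonneg j
  · exact L.singularValues_antitone (Nat.zero_le _)

theorem exists_norm_apply_eq_singularValues_zero {m k : ℕ} (hk : 0 < k)
    (L : EuclideanSpace ℂ (Fin k) →ₗ[ℂ] EuclideanSpace ℂ (Fin m)) :
    ∃ v, ‖v‖ = 1 ∧ ‖L v‖ = L.singularValues 0 := by
  set b := L.isSymmetric_adjoint_comp_self.eigenvectorBasis finrank_euclideanSpace_fin with hb
  refine ⟨b ⟨0, hk⟩, b.orthonormal.1 _, ?_⟩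
  rw [← sq_eq_sq₀ (norm_nonneg _) (L.singularValues_nonneg 0),
    norm_sq_apply_eq_sum_singularValues, ← hb, Finset.sum_eq_single ⟨0, hk⟩]
  · simp
  · intro j _ hj
    simp [hj]
  · simp

/-! ### The Krein space numerical range as the image of a hyperboloid -/

theorem sum_range_eq_sum_even_add_sum_odd {M : Type*} [AddCommMonoid M] (n : ℕ) (f : ℕ → M) :
    ∑ i ∈ Finset.range n, f i =
      ∑ a : Fin ((n + 1) / 2), f (2 * a) + ∑ b : Fin (n / 2), f (2 * b + 1) := by
  rw [Finset.sum_range, ← (evenOdd n).sum_comp, Fintype.sum_sum_type]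
  rfl

/-- The squared norm of the part of `x` with even indices below `n`. -/
noncomputable def evenSq (n : ℕ) (x : ℕ → ℂ) : ℝ := ∑ a : Fin ((n + 1) / 2), ‖x (2 * a)‖ ^ 2

/-- The squared norm of the part of `x` with odd indices below `n`. -/
noncomputable def oddSq (n : ℕ) (x : ℕ → ℂ) : ℝ := ∑ b : Fin (n / 2), ‖x (2 * b + 1)‖ ^ 2

theorem evenSq_nonneg (n : ℕ) (x : ℕ → ℂ) : 0 ≤ evenSq n x :=
  Finset.sum_nonneg fun _ _ => by positivity

theorem oddSq_nonneg (n : ℕ) (x : ℕ → ℂ) : 0 ≤ oddSq n x :=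
  Finset.sum_nonneg fun _ _ => by positivity

/-- The contribution `∑ (-1)^j c_j x_j conj x_{j+1}` of the subdiagonal to `-[Tx, x]`. -/
noncomputable def coupling {n : ℕ} (c : Fin (n - 1) → ℂ) (x : ℕ → ℂ) : ℂ :=
  ∑ j ∈ Finset.range (n - 1), (-1) ^ j * extendZero c j * (x j * conj (x (j + 1)))

theorem altSign_mul_triMat (n : ℕ) (d l u : ℕ → ℂ) :
    altSign n * triMat d l u n =
      triMat (fun i => (-1) ^ i * d i) (fun i => (-1) ^ (i + 1) * l i) (fun i => (-1) ^ i * u i)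
        n := by
  ext i j
  rw [altSign, Matrix.diagonal_mul, triMat_apply, triMat_apply]
  simp only [triEntry]
  split_ifs with h1 h2 h3
  · rfl
  · rw [h2]
  · rfl
  · simp

theorem kreinInner_altSign_self (n : ℕ) (x : ℕ → ℂ) :
    kreinInner (altSign n) (fun i : Fin n => x i) (fun i : Fin n => x i) =
      evenSq n x - oddSq n x := by
  have h : kreinInner (altSign n) (fun i : Fin n => x i) (fun i : Fin n => x i) =
      ∑ i ∈ Finset.range n, (-1) ^ i * ((‖x i‖ ^ 2 : ℝ) : ℂ) := by
    rw [Finset.sum_range, kreinInner, altSign, dotProduct]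
    refine Finset.sum_congr rfl fun i _ => ?_
    rw [Matrix.mulVec_diagonal, Pi.star_apply]
    push_cast
    rw [← Complex.conj_mul']
    simp only [RCLike.star_def]
    ring
  rw [h, sum_range_eq_sum_even_add_sum_odd, evenSq, oddSq]
  push_cast
  simp [pow_add, pow_mul, sub_eq_add_neg]

theorem kreinInner_biperiodicTridiag {n : ℕ} (α β κ : ℂ) (c d : Fin (n - 1) → ℂ)
    (hd : ∀ j, d j = κ * star (c j)) (x : ℕ → ℂ) :
    kreinInner (altSign n) (biperiodicTridiag n α β c d *ᵥ fun i : Fin n => x i)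
        (fun i : Fin n => x i) =
      α * evenSq n x - β * oddSq n x + κ * conj (coupling c x) - coupling c x := by
  have hd' : ∀ j, extendZero d j = κ * conj (extendZero c j) := by
    intro j
    by_cases h : j < n - 1
    · rw [extendZero_of_lt _ h, extendZero_of_lt _ h, hd]; rfl
    · simp [extendZero, h]
  have hs : star (fun i : Fin n => x i) = fun i : Fin n => (fun j => conj (x j)) (i : ℕ) := rfl
  rw [kreinInner, biperiodicTridiag_eq_triMat, Matrix.mulVec_mulVec, altSign_mul_triMat, hs,
    dotProduct_triMat_mulVec _ _ _ x (fun j => conj (x j)),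
    sum_range_eq_sum_even_add_sum_odd, add_sub_assoc]
  congr 1
  · rw [evenSq, oddSq]
    push_cast
    simp only [Complex.conj_mul', Finset.mul_sum, sub_eq_add_neg, ← Finset.sum_neg_distrib]
    congr 1
    · refine Finset.sum_congr rfl fun a _ => ?_
      simp [pow_mul]
    · refine Finset.sum_congr rfl fun a _ => ?_
      simp [pow_add, pow_mul]
  · rw [coupling, map_sum, Finset.mul_sum, ← Finset.sum_sub_distrib]
    refine Finset.sum_congr rfl fun j _ => ?_
    rw [hd']
    simp only [map_mul, map_pow, map_neg, map_one, Complex.conj_conj, pow_succ]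
    ring

/-- The bilinear form of `X(c)` written as a sum over the edges `j - (j + 1)` of the path on which
the tridiagonal matrix lives. -/
theorem dotProduct_bidiag_mulVec {n : ℕ} (c : Fin (n - 1) → ℂ) (x y : ℕ → ℂ) :
    (fun a : Fin ((n + 1) / 2) => y (2 * a)) ⬝ᵥ
        (bidiag n c *ᵥ fun b : Fin (n / 2) => x (2 * b + 1)) =
      ∑ j ∈ Finset.range (n - 1), extendZero c j *
        (if Even j then y j * x (j + 1) else y (j + 1) * x j) := by
  have h := triMat_submatrix_evenOdd (RingHom.id ℂ) n c 0 0 0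
  have h2 := congrArg (fun M => (fun i : Fin n => y i) ∘ evenOdd n ⬝ᵥ
    (M *ᵥ ((fun i : Fin n => x i) ∘ evenOdd n))) h
  simp only [Matrix.submatrix_mulVec_equiv, Function.comp_assoc, Equiv.self_comp_symm,
    Function.comp_id] at h2
  rw [comp_equiv_dotProduct_comp_equiv, dotProduct_triMat_mulVec] at h2
  rw [Finset.sum_eq_zero (by simp), zero_add] at h2
  have h3 : ∀ v : Fin ((n + 1) / 2) ⊕ Fin (n / 2) → ℂ,
    (Matrix.fromBlocks ((0 : ℂ) • (1 : Matrix (Fin ((n + 1) / 2)) (Fin ((n + 1) / 2)) ℂ))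
      ((bidiag n c).map (RingHom.id ℂ)) ((0 : ℂ) • ((bidiag n c)ᴴ).map (RingHom.id ℂ))
      ((0 : ℂ) • (1 : Matrix (Fin (n / 2)) (Fin (n / 2)) ℂ))) *ᵥ v =
      Sum.elim (bidiag n c *ᵥ (v ∘ Sum.inr)) 0 := by
    intro v
    rw [Matrix.fromBlocks_mulVec]
    simp
  rw [h3, dotProduct, Fintype.sum_sum_type] at h2
  simp only [Sum.elim_inr, Pi.zero_apply, mul_zero, Finset.sum_const_zero, add_zero,
    Sum.elim_inl] at h2
  refine Eq.trans ?_ (h2.symm.trans ?_)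
  · rfl
  · refine Finset.sum_congr rfl fun j _ => ?_
    split_ifs <;> simp

theorem exists_conj_mul_eq_norm (z : ℂ) : ∃ u : ℂ, ‖u‖ = 1 ∧ conj u * z = ‖z‖ := by
  by_cases hz : z = 0
  · exact ⟨1, by simp, by simp [hz]⟩
  · have hz' : (‖z‖ : ℂ) ≠ 0 := by exact_mod_cast norm_ne_zero_iff.mpr hz
    refine ⟨z / ‖z‖, by simp [hz], ?_⟩
    rw [map_div₀, Complex.conj_ofReal, div_mul_eq_mul_div, Complex.conj_mul', div_eq_iff hz']
    ring

/-- On a path the phases of successive coordinates can be adjusted at will. -/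
theorem exists_phases (z : ℕ → ℂ) :
    ∃ θ : ℕ → ℂ, (∀ j, ‖θ j‖ = 1) ∧ ∀ j, θ j * conj (θ (j + 1)) * z j = ‖z j‖ := by
  choose u hu huz using fun j => exists_conj_mul_eq_norm (z j)
  have hθ : ∀ j, ‖∏ i ∈ Finset.range j, u i‖ = 1 := fun j => by
    rw [norm_prod, Finset.prod_eq_one fun i _ => hu i]
  refine ⟨fun j => ∏ i ∈ Finset.range j, u i, hθ, fun j => ?_⟩
  simp only [Finset.prod_range_succ, map_mul]
  rw [← mul_assoc, Complex.mul_conj', hθ j, ← huz j]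
  simp

theorem evenSq_congr {n : ℕ} {x y : ℕ → ℂ} (h : ∀ j, ‖x j‖ = ‖y j‖) :
    evenSq n x = evenSq n y := by simp [evenSq, h]

theorem oddSq_congr {n : ℕ} {x y : ℕ → ℂ} (h : ∀ j, ‖x j‖ = ‖y j‖) :
    oddSq n x = oddSq n y := by simp [oddSq, h]

theorem norm_dotProduct_bidiag_mulVec_le {n : ℕ} (c : Fin (n - 1) → ℂ) (y : ℕ → ℂ) :
    ‖(fun a : Fin ((n + 1) / 2) => conj (y (2 * a))) ⬝ᵥ
        (bidiag n c *ᵥ fun b : Fin (n / 2) => y (2 * b + 1))‖ ≤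
      bidiagSing n c 0 * (√(evenSq n y) * √(oddSq n y)) := by
  set ye : EuclideanSpace ℂ (Fin ((n + 1) / 2)) := WithLp.toLp 2 fun a => y (2 * a)
  set yo : EuclideanSpace ℂ (Fin (n / 2)) := WithLp.toLp 2 fun b => y (2 * b + 1)
  have h1 : (fun a : Fin ((n + 1) / 2) => conj (y (2 * a))) ⬝ᵥ
      (bidiag n c *ᵥ fun b : Fin (n / 2) => y (2 * b + 1)) =
      inner ℂ ye (Matrix.toEuclideanLin (bidiag n c) yo) := by
    rw [EuclideanSpace.inner_eq_star_dotProduct, dotProduct_comm]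
    rfl
  have he : ‖ye‖ = √(evenSq n y) := by rw [EuclideanSpace.norm_eq]; rfl
  have ho : ‖yo‖ = √(oddSq n y) := by rw [EuclideanSpace.norm_eq]; rfl
  rw [h1, ← he, ← ho]
  refine (norm_inner_le_norm _ _).trans ?_
  calc ‖ye‖ * ‖Matrix.toEuclideanLin (bidiag n c) yo‖
      ≤ ‖ye‖ * (bidiagSing n c 0 * ‖yo‖) := by
        gcongr
        exact norm_apply_le_singularValues_zero _ _
    _ = _ := by ring

/-- The phases of the entries of `X(c)` do not matter for its norm: the bound by the greatest
singular value survives when all terms are replaced by their moduli. -/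
theorem sum_norm_mul_le {n : ℕ} (c : Fin (n - 1) → ℂ) (x : ℕ → ℂ) :
    ∑ j ∈ Finset.range (n - 1), ‖extendZero c j‖ * (‖x j‖ * ‖x (j + 1)‖) ≤
      bidiagSing n c 0 * (√(evenSq n x) * √(oddSq n x)) := by
  obtain ⟨θ, hθ, hθc⟩ := exists_phases
    fun j => if Even j then conj (extendZero c j) else extendZero c j
  -- a vector with the same moduli as `x`, at which all terms of the form of `X(c)` are nonnegative
  set y : ℕ → ℂ := fun j => ‖x j‖ * θ j with hy
  have hyx : ∀ j, ‖y j‖ = ‖x j‖ := fun j => by simp [hy, hθ]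
  rw [← evenSq_congr hyx, ← oddSq_congr hyx]
  refine le_trans (le_of_eq ?_) (norm_dotProduct_bidiag_mulVec_le c y)
  rw [dotProduct_bidiag_mulVec c y fun j => conj (y j)]
  have h : ∀ j, extendZero c j *
      (if Even j then conj (y j) * y (j + 1) else conj (y (j + 1)) * y j) =
      ((‖extendZero c j‖ * (‖x j‖ * ‖x (j + 1)‖) : ℝ) : ℂ) := by
    intro j
    have h1 := hθc j
    by_cases hj : Even j
    · simp only [hj, if_true] at h1 ⊢
      have h2 := congrArg conj h1
      simp only [map_mul, Complex.conj_conj, Complex.conj_ofReal, Complex.norm_conj] at h2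
      simp only [hy, map_mul, Complex.conj_ofReal]
      push_cast
      rw [← h2]; ring
    · simp only [hj, if_false] at h1 ⊢
      simp only [hy, map_mul, Complex.conj_ofReal]
      push_cast
      rw [← h1]; ring
  rw [Finset.sum_congr rfl fun j _ => h j, ← Complex.ofReal_sum, Complex.norm_real,
    Real.norm_of_nonneg]
  exact Finset.sum_nonneg fun j _ => by positivity

/-- Equality in `sum_norm_mul_le` holds at a pair of singular vectors for the greatest singular
value, placed at the even and the odd indices. -/
theorem exists_sum_norm_mul_eq {n : ℕ} (hn : 2 ≤ n) (c : Fin (n - 1) → ℂ)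
    (hs : 0 < bidiagSing n c 0) :
    ∃ x : ℕ → ℂ, evenSq n x = 1 ∧ oddSq n x = 1 ∧
      ∑ j ∈ Finset.range (n - 1), ‖extendZero c j‖ * (‖x j‖ * ‖x (j + 1)‖) = bidiagSing n c 0 := by
  obtain ⟨v, hv, hXv⟩ := exists_norm_apply_eq_singularValues_zero (by omega : 0 < n / 2)
    (Matrix.toEuclideanLin (bidiag n c))
  change ‖_‖ = bidiagSing n c 0 at hXv
  set s := bidiagSing n c 0 with hs_def
  set u : EuclideanSpace ℂ (Fin ((n + 1) / 2)) :=
    ((s⁻¹ : ℝ) : ℂ) • Matrix.toEuclideanLin (bidiag n c) v with hu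
  have hun : ‖u‖ = 1 := by
    rw [hu, norm_smul, hXv, Complex.norm_real, Real.norm_of_nonneg (by positivity),
      inv_mul_cancel₀ hs.ne']
  set x : ℕ → ℂ := fun j => if h : j < n then Sum.elim u v ((evenOdd n).symm ⟨j, h⟩) else 0 with hx
  have hxe : ∀ a : Fin ((n + 1) / 2), x (2 * a) = u a := by
    intro a
    have h : (⟨2 * a, by omega⟩ : Fin n) = evenOdd n (Sum.inl a) := rfl
    simp only [hx]
    rw [dif_pos (by omega), h, Equiv.symm_apply_apply, Sum.elim_inl]
  have hxo : ∀ b : Fin (n / 2), x (2 * b + 1) = v b := by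
    intro b
    have h : (⟨2 * b + 1, by omega⟩ : Fin n) = evenOdd n (Sum.inr b) := rfl
    simp only [hx]
    rw [dif_pos (by omega), h, Equiv.symm_apply_apply, Sum.elim_inr]
  have h1 : evenSq n x = 1 := by
    simp only [evenSq, hxe]
    rw [← EuclideanSpace.norm_sq_eq, hun, one_pow]
  have h2 : oddSq n x = 1 := by
    simp only [oddSq, hxo]
    rw [← EuclideanSpace.norm_sq_eq, hv, one_pow]
  refine ⟨x, h1, h2, le_antisymm ?_ ?_⟩
  · simpa [h1, h2] using sum_norm_mul_le c x
  · have h3 : (s : ℂ) = ∑ j ∈ Finset.range (n - 1), extendZero c j *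
        (if Even j then conj (x j) * x (j + 1) else conj (x (j + 1)) * x j) := by
      rw [← dotProduct_bidiag_mulVec c x fun j => conj (x j)]
      simp only [hxe, hxo]
      have h4 : inner ℂ u (Matrix.toEuclideanLin (bidiag n c) v) = (s : ℂ) := by
        rw [hu, inner_smul_left, inner_self_eq_norm_sq_to_K, hXv]
        have h6 : ((s⁻¹ : ℝ) : ℂ) * (s : ℂ) ^ 2 = s := by
          have : (s : ℂ) ≠ 0 := by exact_mod_cast hs.ne'
          push_cast
          field_simp
        rw [Complex.conj_ofReal]
        exact h6
      rw [← h4, EuclideanSpace.inner_eq_star_dotProduct, dotProduct_comm]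
      rfl
    have h5 : ‖(s : ℂ)‖ = s := by rw [Complex.norm_real, Real.norm_of_nonneg hs.le]
    rw [← h5, h3]
    refine (norm_sum_le _ _).trans (Finset.sum_le_sum fun j _ => ?_)
    split_ifs
    · rw [norm_mul, norm_mul, Complex.norm_conj]
    · rw [norm_mul, norm_mul, Complex.norm_conj, mul_comm ‖x (j + 1)‖]

/-- The image of the solid two-sheeted hyperboloid `t² - |y|² ≥ 1` under the real linear map
`(t, y) ↦ ω t + (s / 2) (κ conj y - y)`, translated to the centre `(α + β) / 2`. -/
def hyperboloidImage (α β κ : ℂ) (s : ℝ) : Set ℂ :=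
  {z | ∃ (t : ℝ) (y : ℂ), 1 + ‖y‖ ^ 2 ≤ t ^ 2 ∧
    z = (α + β) / 2 + (α - β) / 2 * t + s / 2 * (κ * conj y - y)}

theorem mem_kreinRange_altSign_iff {n : ℕ} (α β κ : ℂ) (c d : Fin (n - 1) → ℂ)
    (hd : ∀ j, d j = κ * star (c j)) (z : ℂ) :
    z ∈ kreinRange (altSign n) (biperiodicTridiag n α β c d) ↔
      ∃ (x : ℕ → ℂ) (σ : ℝ), σ ^ 2 = 1 ∧ evenSq n x - oddSq n x = σ ∧
        z * σ = α * evenSq n x - β * oddSq n x + κ * conj (coupling c x) - coupling c x := by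
  have hext : ∀ x : Fin n → ℂ, ∃ x' : ℕ → ℂ, x = fun i : Fin n => x' i := fun x =>
    ⟨fun j => if h : j < n then x ⟨j, h⟩ else 0, by simp⟩
  constructor
  · rintro (⟨x, h1, h2⟩ | ⟨x, h1, h2⟩) <;> obtain ⟨x, rfl⟩ := hext x
    · rw [kreinInner_altSign_self] at h1
      rw [kreinInner_biperiodicTridiag _ _ _ _ _ hd] at h2
      refine ⟨x, -1, by norm_num, by exact_mod_cast h1, ?_⟩
      rw [h2]; simp
    · rw [kreinInner_altSign_self] at h1
      rw [kreinInner_biperiodicTridiag _ _ _ _ _ hd] at h2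
      refine ⟨x, 1, by norm_num, by exact_mod_cast h1, ?_⟩
      rw [h2]; simp
  · rintro ⟨x, σ, hσ, h1, h2⟩
    rcases (sq_eq_sq_iff_eq_or_eq_neg.mp (hσ.trans (one_pow 2).symm)) with rfl | rfl
    · refine Or.inr ⟨fun i => x i, ?_, ?_⟩
      · rw [kreinInner_altSign_self]; exact_mod_cast h1
      · rw [kreinInner_biperiodicTridiag _ _ _ _ _ hd, ← h2]; simp
    · refine Or.inl ⟨fun i => x i, ?_, ?_⟩
      · rw [kreinInner_altSign_self]; exact_mod_cast h1
      · rw [kreinInner_biperiodicTridiag _ _ _ _ _ hd, ← h2]; simp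

/-- The Krein space numerical range lies in the image of the solid hyperboloid: put
`t = ± (E + O)` and `y = ± 2 S / s`, with `E`, `O` the two squared norms, `E - O = ± 1`, and `S` the
coupling, for which `|S| ≤ s √(E O)`. -/
theorem kreinRange_subset_hyperboloidImage {n : ℕ} (α β κ : ℂ) (c d : Fin (n - 1) → ℂ)
    (hd : ∀ j, d j = κ * star (c j)) (hs : 0 < bidiagSing n c 0) :
    kreinRange (altSign n) (biperiodicTridiag n α β c d) ⊆
      hyperboloidImage α β κ (bidiagSing n c 0) := by
  intro z hz
  obtain ⟨x, σ, hσ, h1, h2⟩ := (mem_kreinRange_altSign_iff α β κ c d hd z).mp hz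
  set s := bidiagSing n c 0
  set E := evenSq n x with hE_def
  set O := oddSq n x with hO_def
  have hE : 0 ≤ E := evenSq_nonneg n x
  have hO : 0 ≤ O := oddSq_nonneg n x
  set S := coupling c x with hS_def
  have hS : ‖S‖ ≤ s * (√E * √O) := by
    refine le_trans ?_ (sum_norm_mul_le c x)
    refine (norm_sum_le _ _).trans (Finset.sum_le_sum fun j _ => ?_)
    simp
  have hS2 : ‖S‖ ^ 2 ≤ s ^ 2 * (E * O) := by
    calc ‖S‖ ^ 2 ≤ (s * (√E * √O)) ^ 2 := by gcongr
      _ = s ^ 2 * (E * O) := by rw [mul_pow, mul_pow, Real.sq_sqrt hE, Real.sq_sqrt hO]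
  have hsc : (s : ℂ) ≠ 0 := by exact_mod_cast hs.ne'
  refine ⟨σ * (E + O), σ * (2 / s) * S, ?_, ?_⟩
  · have h3 : ‖(σ : ℂ) * (2 / s) * S‖ ^ 2 = 4 * ‖S‖ ^ 2 / s ^ 2 := by
      rw [norm_mul, norm_mul, norm_div, mul_pow, mul_pow, Complex.norm_real, Complex.norm_real,
        Real.norm_eq_abs, sq_abs, hσ, Real.norm_of_nonneg hs.le]
      simp; ring
    have h4 : ‖S‖ ^ 2 / s ^ 2 ≤ E * O := by
      rw [div_le_iff₀ (by positivity)]; linarith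
    rw [h3, mul_pow, hσ]
    have h5 : (E - O) ^ 2 = 1 := by rw [h1, hσ]
    have h6 : 4 * ‖S‖ ^ 2 / s ^ 2 = 4 * (‖S‖ ^ 2 / s ^ 2) := by ring
    rw [h6]
    linarith
  · have hσc : (σ : ℂ) * σ = 1 := by rw [← sq]; exact_mod_cast hσ
    have h1c : (E : ℂ) - O = σ := by exact_mod_cast h1
    have h3 : z = σ * (z * σ) := by linear_combination (-z) * hσc
    rw [h3, h2]
    simp only [map_mul, map_div₀, Complex.conj_ofReal, map_ofNat]
    push_cast
    field_simp
    linear_combination (α + β) * σ * h1c + (α + β) * hσc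

/-- Conversely, already the boundary of the hyperboloid is covered: take the moduli of the
coordinates from a pair of singular vectors, and choose the phases so that all terms of the
coupling are aligned. -/
theorem mem_kreinRange_of_hyperboloid {n : ℕ} (hn : 2 ≤ n) (α β κ : ℂ) (c d : Fin (n - 1) → ℂ)
    (hd : ∀ j, d j = κ * star (c j)) (hs : 0 < bidiagSing n c 0) (t : ℝ) (y : ℂ)
    (hty : t ^ 2 = 1 + ‖y‖ ^ 2) :
    (α + β) / 2 + (α - β) / 2 * t + (bidiagSing n c 0) / 2 * (κ * conj y - y) ∈
      kreinRange (altSign n) (biperiodicTridiag n α β c d) := by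
  rw [mem_kreinRange_altSign_iff α β κ c d hd]
  obtain ⟨r, hrE, hrO, hr⟩ := exists_sum_norm_mul_eq hn c hs
  set s := bidiagSing n c 0
  obtain ⟨σ, hσ, hσt⟩ : ∃ σ : ℝ, σ ^ 2 = 1 ∧ |t| = σ * t := by
    rcases abs_cases t with h | h
    · exact ⟨1, by norm_num, by rw [h.1, one_mul]⟩
    · exact ⟨-1, by norm_num, by rw [h.1, neg_one_mul]⟩
  have ht1 : 1 ≤ |t| := by
    rw [← one_le_sq_iff_one_le_abs, hty]
    nlinarith [sq_nonneg ‖y‖]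
  have hσ1 : |σ| = 1 := by
    have := sq_abs σ
    rw [hσ] at this
    exact (pow_eq_one_iff_of_nonneg (abs_nonneg σ) two_ne_zero).mp this
  have hσ2 := abs_le.mp hσ1.le
  set E := (|t| + σ) / 2 with hE_def
  set O := (|t| - σ) / 2 with hO_def
  have hE : 0 ≤ E := by rw [hE_def]; linarith [hσ2.1]
  have hO : 0 ≤ O := by rw [hO_def]; linarith [hσ2.2]
  have hEO : E * O = (‖y‖ / 2) ^ 2 := by
    have : E * O = (|t| ^ 2 - σ ^ 2) / 4 := by rw [hE_def, hO_def]; ring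
    rw [this, sq_abs, hσ, hty]; ring
  obtain ⟨u, hu, huy⟩ := exists_conj_mul_eq_norm y
  obtain ⟨θ, hθ, hθc⟩ := exists_phases fun j => conj (σ * u) * ((-1) ^ j * extendZero c j)
  have hy : y = u * ‖y‖ := by
    rw [← huy, ← mul_assoc, Complex.mul_conj', hu]; simp
  have hσc : (σ : ℂ) * σ = 1 := by rw [← sq]; exact_mod_cast hσ
  have hterm : ∀ j, (-1) ^ j * extendZero c j * (θ j * conj (θ (j + 1))) =
      σ * u * ‖extendZero c j‖ := by
    intro j
    have h1 : ‖conj ((σ : ℂ) * u) * ((-1) ^ j * extendZero c j)‖ = ‖extendZero c j‖ := by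
      simp [hu, hσ1]
    have h2 := hθc j
    simp only [h1] at h2
    rw [← h2]
    have h3 : u * conj u = 1 := by rw [Complex.mul_conj', hu]; simp
    rw [map_mul, Complex.conj_ofReal]
    linear_combination (-(-1) ^ j * extendZero c j * (θ j * conj (θ (j + 1)))) *
      (u * conj u * hσc + h3)
  set x : ℕ → ℂ := fun j => ((if Even j then √E else √O) * ‖r j‖ : ℝ) * θ j with hx
  have hxE : evenSq n x = E := by
    have h1 : ∀ a : ℕ, ‖x (2 * a)‖ ^ 2 = E * ‖r (2 * a)‖ ^ 2 := by
      intro a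
      simp [hx, hθ, mul_pow, Real.sq_sqrt hE]
    simp only [evenSq, h1, ← Finset.mul_sum]
    rw [← evenSq, hrE, mul_one]
  have hxO : oddSq n x = O := by
    have h1 : ∀ a : ℕ, ‖x (2 * a + 1)‖ ^ 2 = O * ‖r (2 * a + 1)‖ ^ 2 := by
      intro a
      simp [hx, hθ, mul_pow, Real.sq_sqrt hO]
    simp only [oddSq, h1, ← Finset.mul_sum]
    rw [← oddSq, hrO, mul_one]
  have hsq : √E * √O = ‖y‖ / 2 := by
    rw [← Real.sqrt_mul hE, hEO, Real.sqrt_sq (by positivity)]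
  have hxS : coupling c x = σ * (s / 2) * y := by
    have h1 : ∀ j, (-1) ^ j * extendZero c j * (x j * conj (x (j + 1))) =
        (σ * u * (‖y‖ / 2)) * ((‖extendZero c j‖ * (‖r j‖ * ‖r (j + 1)‖) : ℝ) : ℂ) := by
      intro j
      have h2 : x j * conj (x (j + 1)) = ((√E * √O : ℝ) : ℂ) * (‖r j‖ * ‖r (j + 1)‖) *
          (θ j * conj (θ (j + 1))) := by
        simp only [hx, map_mul, Complex.conj_ofReal, Nat.even_add_one]
        push_cast
        by_cases hj : Even j
        · simp only [hj, if_true, not_true, if_false]; ring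
        · simp only [hj, if_false, not_false_iff, if_true]; ring
      rw [h2, hsq]
      push_cast
      linear_combination ((‖y‖ : ℂ) / 2 * (‖r j‖ * ‖r (j + 1)‖)) * hterm j
    rw [coupling, Finset.sum_congr rfl fun j _ => h1 j, ← Finset.mul_sum, ← Complex.ofReal_sum, hr]
    nth_rw 2 [hy]
    ring
  have hσt' : ((|t| : ℝ) : ℂ) = σ * t := by rw [hσt]; push_cast; ring
  refine ⟨x, σ, hσ, ?_, ?_⟩
  · rw [hxE, hxO, hE_def, hO_def]; ring
  · rw [hxE, hxO, hxS, hE_def, hO_def]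
    push_cast
    rw [hσt']
    simp only [map_mul, map_div₀, Complex.conj_ofReal, map_ofNat]
    ring

/-! ### Plane geometry of the hyperbolas -/

/-- The square `ω² + κ s²` of half the difference of the foci. -/
noncomputable def focalSq (ω κ : ℂ) (s : ℝ) : ℂ := ω ^ 2 + κ * (s : ℂ) ^ 2

/-- `|ω|² - (|κ|² + 1) s² / 2`, which is the squared transverse semi-axis minus the squared
non-transverse one. -/
noncomputable def axisDiff (ω κ : ℂ) (s : ℝ) : ℝ := ‖ω‖ ^ 2 - (‖κ‖ ^ 2 + 1) / 2 * s ^ 2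

/-- The real quadratic form `Re (ζ² conj F) - h |ζ|²`. The hyperbola with foci `± √F` and squared
semi-axes `(|F| ± h) / 2` is its level set at `(|F|² - h²) / 2`. -/
noncomputable def hypForm (F : ℂ) (h : ℝ) (ζ : ℂ) : ℝ := (ζ ^ 2 * conj F).re - h * ‖ζ‖ ^ 2

/-- Completing the square: the level condition for the quadratic form compares the product
`|ζ² - F|` of the focal distances with `|ζ|² - h`. -/
theorem norm_sq_sub_sq_eq (F ζ : ℂ) (h : ℝ) :
    ‖ζ ^ 2 - F‖ ^ 2 - (‖ζ‖ ^ 2 - h) ^ 2 = (‖F‖ ^ 2 - h ^ 2) - 2 * hypForm F h ζ := by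
  simp only [hypForm, Complex.sq_norm, Complex.normSq_apply]
  simp only [Complex.mul_re, Complex.conj_re, Complex.conj_im, Complex.sub_re, Complex.sub_im, sq,
    Complex.mul_im]
  ring

/-- The sign condition that makes it possible to square `|ζ² - F| ≤ |ζ|² - h`. -/
theorem le_norm_sq_of_hypForm {F ζ : ℂ} {h : ℝ} (hF : |h| < ‖F‖)
    (hζ : (‖F‖ ^ 2 - h ^ 2) / 2 ≤ hypForm F h ζ) : h ≤ ‖ζ‖ ^ 2 := by
  have h1 : (ζ ^ 2 * conj F).re ≤ ‖ζ‖ ^ 2 * ‖F‖ := by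
    refine (Complex.re_le_norm _).trans (le_of_eq ?_)
    rw [norm_mul, norm_pow, Complex.norm_conj]
  have h2 := abs_lt.mp hF
  rw [hypForm] at hζ
  have h3 : (‖F‖ - h) * ((‖F‖ + h) / 2) ≤ (‖F‖ - h) * ‖ζ‖ ^ 2 := by nlinarith
  have h4 := le_of_mul_le_mul_left h3 (by linarith [h2.2])
  linarith [h2.2]

theorem norm_le_iff_hypForm {F : ℂ} {h : ℝ} (hF : |h| < ‖F‖) (ζ : ℂ) :
    ‖ζ ^ 2 - F‖ ≤ ‖ζ‖ ^ 2 - h ↔ (‖F‖ ^ 2 - h ^ 2) / 2 ≤ hypForm F h ζ := by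
  have h1 := norm_sq_sub_sq_eq F ζ h
  constructor
  · intro h2
    have h3 : ‖ζ ^ 2 - F‖ ^ 2 ≤ (‖ζ‖ ^ 2 - h) ^ 2 := by gcongr
    linarith
  · intro h2
    have h3 := le_norm_sq_of_hypForm hF h2
    exact le_of_sq_le_sq (by linarith) (by linarith)

theorem norm_eq_iff_hypForm {F : ℂ} {h : ℝ} (hF : |h| < ‖F‖) (ζ : ℂ) :
    ‖ζ ^ 2 - F‖ = ‖ζ‖ ^ 2 - h ↔ hypForm F h ζ = (‖F‖ ^ 2 - h ^ 2) / 2 := by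
  have h1 := norm_sq_sub_sq_eq F ζ h
  constructor
  · intro h2
    rw [h2] at h1
    linarith
  · intro h2
    have h3 := le_norm_sq_of_hypForm hF h2.ge
    rw [← sq_eq_sq₀ (norm_nonneg _) (by linarith)]
    linarith

theorem sq_dist_sub_dist (m f z : ℂ) :
    (dist z (m + f) - dist z (m - f)) ^ 2 =
      2 * (‖z - m‖ ^ 2 + ‖f ^ 2‖ - ‖(z - m) ^ 2 - f ^ 2‖) := by
  have h1 : dist z (m + f) * dist z (m - f) = ‖(z - m) ^ 2 - f ^ 2‖ := by
    rw [dist_eq_norm, dist_eq_norm, ← norm_mul]; congr 1; ring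
  have h2 := parallelogram_law_with_norm ℝ (z - m) f
  have h3 : dist z (m + f) = ‖(z - m) - f‖ := by rw [dist_eq_norm]; congr 1; ring
  have h4 : dist z (m - f) = ‖(z - m) + f‖ := by rw [dist_eq_norm]; congr 1; ring
  rw [norm_pow]
  rw [sub_sq, mul_assoc, h1, h3, h4]
  linarith

theorem isHyperbolaData_iff {m f F : ℂ} {h b : ℝ} (hf : f ^ 2 = F)
    (hb : b = √(2 * ‖F‖ - 2 * h)) : IsHyperbolaData (m + f) (m - f) b ↔ |h| < ‖F‖ := by
  have hd : dist (m + f) (m - f) = 2 * ‖f‖ := by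
    rw [dist_eq_norm, show m + f - (m - f) = 2 * f by ring, norm_mul]; simp
  have hF : ‖F‖ = ‖f‖ ^ 2 := by rw [← hf, norm_pow]
  rw [IsHyperbolaData, hd, hb, Real.sqrt_pos, abs_lt]
  have key : √(2 * ‖F‖ - 2 * h) < 2 * ‖f‖ → 2 * ‖F‖ - 2 * h < 4 * ‖F‖ := by
    intro h1
    have := (Real.sqrt_lt' ((Real.sqrt_nonneg _).trans_lt h1)).mp h1
    rw [hF] at this ⊢; linarith
  constructor
  · rintro ⟨h1, h2⟩
    have := key h2
    constructor <;> linarith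
  · rintro ⟨h1, h2⟩
    refine ⟨by linarith, ?_⟩
    have h3 : 0 < ‖F‖ := by linarith
    have h4 : 0 < ‖f‖ := by
      rw [hF] at h3
      exact lt_of_le_of_ne (norm_nonneg f) (fun h => by rw [← h] at h3; simp at h3)
    rw [Real.sqrt_lt' (by positivity)]
    rw [hF] at h1 ⊢; linarith

theorem sqrt_dist_sq_sub_sq {m f F : ℂ} {h b : ℝ} (hf : f ^ 2 = F)
    (hb : b = √(2 * ‖F‖ - 2 * h)) (hF : |h| < ‖F‖) :
    √(dist (m + f) (m - f) ^ 2 - b ^ 2) = √(2 * (‖F‖ + h)) := by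
  have hd : dist (m + f) (m - f) = 2 * ‖f‖ := by
    rw [dist_eq_norm, show m + f - (m - f) = 2 * f by ring, norm_mul]; simp
  have hF' : ‖F‖ = ‖f‖ ^ 2 := by rw [← hf, norm_pow]
  have h1 := abs_lt.mp hF
  rw [hd, hb, Real.sq_sqrt (by linarith), mul_pow, ← hF']
  congr 1; ring

theorem mem_hyperbolicDisc_iff {m f F : ℂ} {h b : ℝ} (hf : f ^ 2 = F)
    (hb : b = √(2 * ‖F‖ - 2 * h)) (hF : |h| < ‖F‖) (z : ℂ) :
    z ∈ hyperbolicDisc (m + f) (m - f) b ↔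
      (‖F‖ ^ 2 - h ^ 2) / 2 ≤ hypForm F h (z - m) := by
  rw [hyperbolicDisc, Set.mem_ofPred_eq, sqrt_dist_sq_sub_sq hf hb hF, ← norm_le_iff_hypForm hF,
    Real.sqrt_le_left (abs_nonneg _), sq_abs, sq_dist_sub_dist, hf]
  constructor <;> intro h1 <;> linarith

theorem mem_hyperbola_iff {m f F : ℂ} {h b : ℝ} (hf : f ^ 2 = F)
    (hb : b = √(2 * ‖F‖ - 2 * h)) (hF : |h| < ‖F‖) (z : ℂ) :
    z ∈ hyperbola (m + f) (m - f) b ↔ hypForm F h (z - m) = (‖F‖ ^ 2 - h ^ 2) / 2 := by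
  have h1 := abs_lt.mp hF
  rw [hyperbola, Set.mem_ofPred_eq, sqrt_dist_sq_sub_sq hf hb hF, ← norm_eq_iff_hypForm hF,
    eq_comm, Real.sqrt_eq_iff_eq_sq (by linarith) (abs_nonneg _), sq_abs, sq_dist_sub_dist, hf]
  constructor <;> intro h1 <;> linarith

/-- The discriminant of the hyperbola, as a function of `s`. It shows that nondegeneracy persists
when `s > 0` decreases. -/
theorem norm_focalSq_sq_sub (ω κ : ℂ) (s : ℝ) :
    ‖focalSq ω κ s‖ ^ 2 - axisDiff ω κ s ^ 2 =
      s ^ 2 * (‖ω + κ * conj ω‖ ^ 2 - s ^ 2 * (1 - ‖κ‖ ^ 2) ^ 2 / 4) := by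
  simp only [focalSq, axisDiff, Complex.sq_norm, Complex.normSq_apply]
  simp only [Complex.mul_re, Complex.conj_re, Complex.conj_im, Complex.add_re, Complex.add_im, sq,
    Complex.mul_im, Complex.ofReal_re, Complex.ofReal_im]
  ring

theorem abs_axisDiff_lt_iff (ω κ : ℂ) {s : ℝ} (hs : 0 < s) :
    |axisDiff ω κ s| < ‖focalSq ω κ s‖ ↔ s ^ 2 * (1 - ‖κ‖ ^ 2) ^ 2 / 4 < ‖ω + κ * conj ω‖ ^ 2 := by
  rw [← abs_of_nonneg (norm_nonneg (focalSq ω κ s)), ← sq_lt_sq, ← sub_pos, norm_focalSq_sq_sub,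
    mul_pos_iff_of_pos_left (by positivity), sub_pos]

theorem abs_axisDiff_lt_of_le (ω κ : ℂ) {s s' : ℝ} (hs : 0 < s) (hss' : s ≤ s')
    (h : |axisDiff ω κ s'| < ‖focalSq ω κ s'‖) : |axisDiff ω κ s| < ‖focalSq ω κ s‖ := by
  rw [abs_axisDiff_lt_iff ω κ (hs.trans_le hss')] at h
  rw [abs_axisDiff_lt_iff ω κ hs]
  refine lt_of_le_of_lt ?_ h
  gcongr

/-- The quadratic form at the image of `p = (t, y)`. The last square is that of the Lorentz product
of `p` with the vector `(s² (1 - |κ|²) / 4, s (ω + κ conj ω) / 2)` spanning the kernel of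
`(t, y) ↦ ω t + (s / 2) (κ conj y - y)`. -/
theorem hypForm_hyperboloidMap (ω κ y : ℂ) (s t : ℝ) :
    hypForm (focalSq ω κ s) (axisDiff ω κ s) (ω * t + s / 2 * (κ * conj y - y)) =
      (t ^ 2 - ‖y‖ ^ 2) * ((‖focalSq ω κ s‖ ^ 2 - axisDiff ω κ s ^ 2) / 2) +
      2 * (t * (s ^ 2 * (1 - ‖κ‖ ^ 2) / 4) - s / 2 * (y * conj (ω + κ * conj ω)).re) ^ 2 := by
  have h2 : ((s : ℂ) / 2) = ((s / 2 : ℝ) : ℂ) := by push_cast; ring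
  rw [norm_focalSq_sq_sub, h2]
  simp only [hypForm, focalSq, axisDiff, Complex.sq_norm, Complex.normSq_apply]
  simp only [Complex.mul_re, Complex.conj_re, Complex.conj_im, Complex.add_re, Complex.add_im, sq,
    Complex.mul_im, Complex.ofReal_re, Complex.ofReal_im, Complex.sub_re, Complex.sub_im]
  ring

theorem hypForm_ge_of_hyperboloid (ω κ y : ℂ) (s t : ℝ)
    (h : |axisDiff ω κ s| < ‖focalSq ω κ s‖) (hty : 1 + ‖y‖ ^ 2 ≤ t ^ 2) :
    (‖focalSq ω κ s‖ ^ 2 - axisDiff ω κ s ^ 2) / 2 ≤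
      hypForm (focalSq ω κ s) (axisDiff ω κ s) (ω * t + s / 2 * (κ * conj y - y)) := by
  rw [hypForm_hyperboloidMap]
  have hD : 0 < ‖focalSq ω κ s‖ ^ 2 - axisDiff ω κ s ^ 2 := by
    rw [sub_pos, sq_lt_sq, abs_of_nonneg (norm_nonneg _)]; exact h
  nlinarith [sq_nonneg (t * (s ^ 2 * (1 - ‖κ‖ ^ 2) / 4) - s / 2 * (y * conj (ω + κ * conj ω)).re)]

/-- Every point of the disc is the image of a point of the hyperboloid. The preimage of `ζ` which is
Lorentz-orthogonal to the (spacelike) kernel lies in the solid hyperboloid; a multiple of the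
kernel vector moves it to the boundary. -/
theorem exists_hyperboloid_of_hypForm_ge (ω κ ζ : ℂ) (s : ℝ)
    (h : |axisDiff ω κ s| < ‖focalSq ω κ s‖)
    (hζ : (‖focalSq ω κ s‖ ^ 2 - axisDiff ω κ s ^ 2) / 2 ≤
      hypForm (focalSq ω κ s) (axisDiff ω κ s) ζ) :
    ∃ (t : ℝ) (y : ℂ), t ^ 2 = 1 + ‖y‖ ^ 2 ∧ ζ = ω * t + s / 2 * (κ * conj y - y) := by
  set F := focalSq ω κ s with hF_def
  set a := axisDiff ω κ s with ha_def
  set D := ‖F‖ ^ 2 - a ^ 2 with hD_def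
  have hD : 0 < D := by
    rw [hD_def, sub_pos, sq_lt_sq, abs_of_nonneg (norm_nonneg _)]; exact h
  have hDc : (D : ℂ) ≠ 0 := by exact_mod_cast hD.ne'
  -- with `L` the linear map and `G` the Lorentz form, `L G Lᵀ ξ = (a ξ + F conj ξ) / 2`; this `ξ`
  -- solves `L G Lᵀ ξ = ζ`, and `(t₀, y₀) = G Lᵀ ξ`, while `(tk, yk)` spans the kernel of `L`
  set ξ : ℂ := 2 * (F * conj ζ - a * ζ) / D with hξ
  set t₀ : ℝ := (ω * conj ξ).re with ht₀
  set y₀ : ℂ := s / 2 * (ξ - κ * conj ξ) with hy₀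
  set tk : ℝ := s ^ 2 * (1 - ‖κ‖ ^ 2) / 4 with htk
  set yk : ℂ := s / 2 * (ω + κ * conj ω) with hyk
  have hκ : ((‖κ‖ ^ 2 : ℝ) : ℂ) = κ * conj κ := by push_cast; rw [Complex.mul_conj']
  have hω : ((‖ω‖ ^ 2 : ℝ) : ℂ) = ω * conj ω := by push_cast; rw [Complex.mul_conj']
  have hk : ω * tk + s / 2 * (κ * conj yk - yk) = 0 := by
    rw [htk, hyk]
    simp only [map_mul, map_div₀, map_add, Complex.conj_ofReal, map_ofNat, Complex.conj_conj]
    push_cast at hκ ⊢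
    rw [hκ]
    ring
  have ht₀c : (t₀ : ℂ) = (ω * conj ξ + conj ω * ξ) / 2 := by
    rw [ht₀, Complex.re_eq_add_conj]
    simp
  have hp₀ : ω * t₀ + s / 2 * (κ * conj y₀ - y₀) = ζ := by
    have h1 : ω * t₀ + s / 2 * (κ * conj y₀ - y₀) = (a * ξ + F * conj ξ) / 2 := by
      rw [ht₀c, hy₀, ha_def, hF_def, axisDiff, focalSq]
      simp only [map_mul, map_div₀, map_sub, Complex.conj_ofReal, map_ofNat, Complex.conj_conj]
      push_cast at hκ hω ⊢
      rw [hκ, hω]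
      ring
    have h2 : (D : ℂ) = F * conj F - a ^ 2 := by
      rw [hD_def]; push_cast; rw [Complex.mul_conj']
    rw [h1, hξ]
    simp only [map_mul, map_div₀, map_sub, Complex.conj_ofReal, map_ofNat, Complex.conj_conj]
    field_simp
    rw [h2]
    ring
  have horth : t₀ * tk - (y₀ * conj yk).re = 0 := by
    have h1 : ((t₀ * tk - (y₀ * conj yk).re : ℝ) : ℂ) = 0 := by
      push_cast
      rw [ht₀c, Complex.re_eq_add_conj, htk, hyk, hy₀]
      simp only [map_mul, map_div₀, map_sub, map_add, Complex.conj_ofReal, map_ofNat,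
        Complex.conj_conj]
      push_cast at hκ ⊢
      rw [hκ]
      ring
    exact_mod_cast h1
  have hkk : tk ^ 2 - ‖yk‖ ^ 2 = -D / 4 := by
    rw [hD_def, hF_def, ha_def, norm_focalSq_sq_sub, htk, hyk, norm_mul, norm_div, mul_pow, div_pow,
      div_pow, Complex.norm_real, Real.norm_eq_abs, sq_abs, Complex.norm_ofNat]
    ring
  have hform : hypForm F a ζ = (t₀ ^ 2 - ‖y₀‖ ^ 2) * (D / 2) := by
    have h1 := hypForm_hyperboloidMap ω κ y₀ s t₀
    rw [hp₀] at h1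
    have h2 : t₀ * (s ^ 2 * (1 - ‖κ‖ ^ 2) / 4) - s / 2 * (y₀ * conj (ω + κ * conj ω)).re =
        t₀ * tk - (y₀ * conj yk).re := by
      rw [htk, hyk, map_mul, map_div₀, Complex.conj_ofReal, map_ofNat,
        show y₀ * ((s : ℂ) / 2 * conj (ω + κ * conj ω)) =
          ((s / 2 : ℝ) : ℂ) * (y₀ * conj (ω + κ * conj ω)) by push_cast; ring,
        Complex.re_ofReal_mul]
    rw [h2, horth] at h1
    rw [h1]
    ring
  have hq : 1 ≤ t₀ ^ 2 - ‖y₀‖ ^ 2 := by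
    rw [hform] at hζ
    by_contra hlt
    nlinarith
  -- the multiple of the kernel vector that brings the Lorentz square down to `1`
  obtain ⟨e, he⟩ : ∃ e : ℝ, e ^ 2 * (D / 4) = t₀ ^ 2 - ‖y₀‖ ^ 2 - 1 := by
    refine ⟨√((t₀ ^ 2 - ‖y₀‖ ^ 2 - 1) / (D / 4)), ?_⟩
    rw [Real.sq_sqrt (div_nonneg (by linarith) (by positivity)), div_mul_cancel₀ _ (by positivity)]
  refine ⟨t₀ + e * tk, y₀ + e * yk, ?_, ?_⟩
  · have h1 : ‖y₀ + e * yk‖ ^ 2 = ‖y₀‖ ^ 2 + 2 * e * (y₀ * conj yk).re + e ^ 2 * ‖yk‖ ^ 2 := by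
      simp only [Complex.sq_norm, Complex.normSq_apply, Complex.mul_re, Complex.conj_re,
        Complex.conj_im, Complex.add_re, Complex.add_im, Complex.mul_im, Complex.ofReal_re,
        Complex.ofReal_im]
      ring
    rw [h1]
    linear_combination 2 * e * horth + e ^ 2 * hkk - he
  · simp only [map_add, map_mul, Complex.conj_ofReal]
    push_cast
    linear_combination -hp₀ - (e : ℂ) * hk

theorem hyperboloidImage_mono (α β κ : ℂ) {s s' : ℝ} (hs : 0 < s) (hss' : s ≤ s') :
    hyperboloidImage α β κ s ⊆ hyperboloidImage α β κ s' := by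
  rintro z ⟨t, y, h, rfl⟩
  have hs' : 0 < s' := hs.trans_le hss'
  have h1 : s / s' ≤ 1 := (div_le_one hs').mpr hss'
  refine ⟨t, ((s / s' : ℝ) : ℂ) * y, ?_, ?_⟩
  · rw [norm_mul, Complex.norm_real, Real.norm_of_nonneg (by positivity)]
    have : (s / s' * ‖y‖) ^ 2 ≤ (1 * ‖y‖) ^ 2 := by gcongr
    rw [one_mul] at this
    linarith
  · have : (s' : ℂ) ≠ 0 := by exact_mod_cast hs'.ne'
    rw [map_mul, Complex.conj_ofReal]
    push_cast
    field_simp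

theorem sq_cpow_half (F : ℂ) : (F ^ (1 / 2 : ℂ)) ^ 2 = F := by simp

theorem nonTransverseAxis_eq (α β κ : ℂ) (s : ℝ) :
    nonTransverseAxis α β κ s = √(2 * ‖focalSq ((α - β) / 2) κ s‖ -
      2 * axisDiff ((α - β) / 2) κ s) := by
  rw [nonTransverseAxis, focalSq, axisDiff]
  congr 1
  ring

/-- A level set of the quadratic form bounds the superlevel set: contracting towards the centre
leaves the superlevel set. -/
theorem frontier_superlevel_hypForm (F m : ℂ) (h e : ℝ) (he : 0 < e) :
    frontier {z | e ≤ hypForm F h (z - m)} = {z | hypForm F h (z - m) = e} := by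
  have hcont : Continuous fun z => hypForm F h (z - m) := by
    unfold hypForm
    fun_prop
  refine Set.Subset.antisymm (fun z hz => (frontier_le_subset_eq continuous_const hcont hz).symm)
    fun z hz => ?_
  simp only [Set.mem_ofPred_eq] at hz
  rw [frontier, (isClosed_le continuous_const hcont).closure_eq]
  refine ⟨hz.ge, fun hint => ?_⟩
  have hlim : Filter.Tendsto (fun r : ℝ => m + (r : ℂ) * (z - m)) (nhdsWithin 1 (Set.Iio 1))
      (nhds z) := by
    have h1 : Continuous fun r : ℝ => m + (r : ℂ) * (z - m) := by fun_prop
    have h2 := h1.tendsto 1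
    simp only [Complex.ofReal_one, one_mul, add_sub_cancel] at h2
    exact h2.mono_left nhdsWithin_le_nhds
  have hev := hlim.eventually (mem_interior_iff_mem_nhds.mp hint)
  have hev2 : ∀ᶠ r : ℝ in nhdsWithin 1 (Set.Iio 1), r ∈ Set.Ioo (0 : ℝ) 1 :=
    Ioo_mem_nhdsLT (by norm_num)
  -- the form is homogeneous of degree `2`, so it takes the value `r² e < e` at the contracted point
  obtain ⟨r, hr, hr0, hr1⟩ := (hev.and hev2).exists
  have hscale : hypForm F h (m + (r : ℂ) * (z - m) - m) = r ^ 2 * e := by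
    rw [← hz, add_sub_cancel_left, hypForm, hypForm, norm_mul, Complex.norm_real, mul_pow, mul_pow,
      Real.norm_eq_abs, sq_abs, mul_assoc, ← Complex.ofReal_pow, Complex.re_ofReal_mul]
    ring
  change e ≤ hypForm F h (m + (r : ℂ) * (z - m) - m) at hr
  rw [hscale] at hr
  have : r ^ 2 < 1 := by nlinarith
  nlinarith

/-! ### The equation of the Kippenhahn curve and its dual -/

/-- The linear form `x u + y v + w` of the point `z = x + i y`. -/
noncomputable def linePoly (z : ℂ) : MvPolynomial (Fin 3) ℂ :=
  MvPolynomial.X 0 * MvPolynomial.C (z.re : ℂ) + MvPolynomial.X 1 * MvPolynomial.C (z.im : ℂ) +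
    MvPolynomial.X 2

/-- The equation in line coordinates of the hyperbola with centre `m`, foci `m ± √F` and squared
semi-axes `(|F| ± h) / 2`. -/
noncomputable def conicPoly (m F : ℂ) (h : ℝ) : MvPolynomial (Fin 3) ℂ :=
  linePoly m ^ 2 - (MvPolynomial.C (((h + F.re) / 2 : ℝ) : ℂ) * MvPolynomial.X 0 ^ 2 +
    MvPolynomial.C (F.im : ℂ) * MvPolynomial.X 0 * MvPolynomial.X 1 +
    MvPolynomial.C (((h - F.re) / 2 : ℝ) : ℂ) * MvPolynomial.X 1 ^ 2)

/-- The lower off-diagonal entries of the pencil `u Re^J(T) + v Im^J(T) + w` are `c_j` times this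
linear form. -/
noncomputable def lowerPoly (κ : ℂ) : MvPolynomial (Fin 3) ℂ :=
  MvPolynomial.X 0 * MvPolynomial.C ((1 - conj κ) / 2) +
    MvPolynomial.X 1 * MvPolynomial.C ((1 + conj κ) / (2 * Complex.I))

/-- The upper off-diagonal entries of the pencil `u Re^J(T) + v Im^J(T) + w` are `conj c_j` times
this linear form. -/
noncomputable def upperPoly (κ : ℂ) : MvPolynomial (Fin 3) ℂ :=
  MvPolynomial.X 0 * MvPolynomial.C ((κ - 1) / 2) +
    MvPolynomial.X 1 * MvPolynomial.C ((κ + 1) / (2 * Complex.I))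

theorem linePoly_mul_linePoly_sub (α β κ : ℂ) (s : ℝ) :
    linePoly α * linePoly β - lowerPoly κ * upperPoly κ * MvPolynomial.C ((s : ℂ) ^ 2) =
      conicPoly ((α + β) / 2) (focalSq ((α - β) / 2) κ s) (axisDiff ((α - β) / 2) κ s) := by
  refine MvPolynomial.funext fun x => ?_
  have hre : ∀ z : ℂ, (z.re : ℂ) = (z + conj z) / 2 := fun z => by
    rw [Complex.re_eq_add_conj]
  have him : ∀ z : ℂ, (z.im : ℂ) = -(z - conj z) * Complex.I / 2 := fun z => by
    rw [Complex.im_eq_sub_conj]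
    field_simp
    rw [Complex.I_sq]; ring
  have hI : ∀ z : ℂ, z / (2 * Complex.I) = -z * Complex.I / 2 := fun z => by
    field_simp
    rw [Complex.I_sq]; ring
  simp only [linePoly, conicPoly, lowerPoly, upperPoly, map_sub, map_add, map_mul, map_pow,
    MvPolynomial.eval_X, MvPolynomial.eval_C, hI, axisDiff]
  push_cast
  simp only [hre, him, ← Complex.mul_conj', focalSq, map_sub, map_add, map_mul, map_pow, map_div₀,
    map_ofNat, Complex.conj_ofReal]
  -- the coefficient is that of `I²` in the difference of the two sides
  linear_combination (x 1 ^ 2 * ((α - conj α) * (β - conj β) / 4 -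
    (s : ℂ) ^ 2 * (1 + conj κ) * (1 + κ) / 4 - (α + β - conj α - conj β) ^ 2 / 16)) * Complex.I_sq

theorem kreinAdjoint_altSign_apply {n : ℕ} (A : Matrix (Fin n) (Fin n) ℂ) (i j : Fin n) :
    kreinAdjoint (altSign n) A i j = (-1) ^ ((i : ℕ) + j) * conj (A j i) := by
  rw [kreinAdjoint, altSign, Matrix.mul_diagonal, Matrix.diagonal_mul, Matrix.conjTranspose_apply,
    pow_add]
  simp only [RCLike.star_def]
  ring

theorem kreinForm_eq_det_triMat {n : ℕ} (α β κ : ℂ) (c d : Fin (n - 1) → ℂ)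
    (hd : ∀ j, d j = κ * star (c j)) :
    kreinForm (altSign n) (biperiodicTridiag n α β c d) =
      (triMat (fun i => if Even i then linePoly α else linePoly β)
        (fun j => MvPolynomial.C (extendZero c j) * lowerPoly κ)
        (fun j => MvPolynomial.C (conj (extendZero c j)) * upperPoly κ) n).det := by
  have hd' : ∀ j, extendZero d j = κ * conj (extendZero c j) := by
    intro j
    by_cases h : j < n - 1
    · rw [extendZero_of_lt _ h, extendZero_of_lt _ h, hd]; rfl
    · simp [extendZero, h]
  have hd'' : ∀ j, conj (extendZero d j) = conj κ * extendZero c j := fun j => by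
    rw [hd', map_mul, Complex.conj_conj]
  rw [kreinForm]
  congr 1
  ext1 i j
  simp only [Matrix.add_apply, Matrix.smul_apply, Matrix.map_apply, kreinRe, kreinIm,
    Matrix.sub_apply, kreinAdjoint_altSign_apply, biperiodicTridiag_eq_triMat, triMat_apply,
    smul_eq_mul, Matrix.one_apply, Fin.ext_iff]
  have hre : ∀ z : ℂ, 1 / 2 * (z + conj z) = (z.re : ℂ) := fun z => by
    rw [Complex.re_eq_add_conj]; ring
  have him : ∀ z : ℂ, 1 / (2 * Complex.I) * (z - conj z) = (z.im : ℂ) := fun z => by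
    rw [Complex.im_eq_sub_conj]; ring
  have hoff : ∀ e p q p' q' : ℂ, p = e * p' → q = e * q' →
      (MvPolynomial.X 0 * MvPolynomial.C p + MvPolynomial.X 1 * MvPolynomial.C q +
        MvPolynomial.X 2 * 0 : MvPolynomial (Fin 3) ℂ) =
      MvPolynomial.C e * (MvPolynomial.X 0 * MvPolynomial.C p' +
        MvPolynomial.X 1 * MvPolynomial.C q') := by
    rintro e p q p' q' rfl rfl
    rw [map_mul, map_mul]
    ring
  by_cases h1 : (i : ℕ) = j
  · have h2 : (-1 : ℂ) ^ ((j : ℕ) + j) = 1 := by rw [← two_mul, pow_mul]; simp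
    simp only [h1, triEntry_diag, h2, one_mul, if_true, mul_one, hre, him]
    split_ifs <;> rfl
  · rw [if_neg h1]
    by_cases h2 : (i : ℕ) = j + 1
    · have h3 : (-1 : ℂ) ^ ((j : ℕ) + 1 + j) = -1 := by
        rw [show (j : ℕ) + 1 + j = 2 * j + 1 by ring, pow_add, pow_mul]; simp
      simp only [h2, triEntry_lower, triEntry_upper, h3, hd'', lowerPoly]
      exact hoff _ _ _ _ _ (by ring) (by ring)
    · by_cases h4 : (j : ℕ) = i + 1
      · have h3 : (-1 : ℂ) ^ ((i : ℕ) + (i + 1)) = -1 := by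
          rw [show (i : ℕ) + (i + 1) = 2 * i + 1 by ring, pow_add, pow_mul]; simp
        simp only [h4, triEntry_lower, triEntry_upper, h3, hd', upperPoly]
        exact hoff _ _ _ _ _ (by ring) (by ring)
      · rw [triEntry_eq_zero _ _ _ (by omega), triEntry_eq_zero _ _ _ (by omega),
          triEntry_eq_zero _ _ _ (by omega)]
        simp

theorem linePoly_ne_zero (z : ℂ) : linePoly z ≠ 0 := by
  intro h
  have := congrArg (MvPolynomial.eval (![0, 0, 1] : Fin 3 → ℂ)) h
  simp [linePoly] at this

/-- The equation of the Kippenhahn curve splits into the equations of the hyperbolas (degenerate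
ones for the vanishing singular values) and, for odd `n`, that of the point `α`. -/
theorem kreinForm_biperiodicTridiag {n : ℕ} (α β κ : ℂ) (c d : Fin (n - 1) → ℂ)
    (hd : ∀ j, d j = κ * star (c j)) :
    kreinForm (altSign n) (biperiodicTridiag n α β c d) =
      linePoly α ^ ((n + 1) / 2 - n / 2) * ∏ j ∈ Finset.range (n / 2),
        conicPoly ((α + β) / 2) (focalSq ((α - β) / 2) κ (bidiagSing n c j))
          (axisDiff ((α - β) / 2) κ (bidiagSing n c j)) := by
  set q := lowerPoly κ * upperPoly κ with hq
  rw [kreinForm_eq_det_triMat α β κ c d hd, det_triMat_congr n _ _ _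
    -- the quadratic form `q` goes with the lower left block, and `X(c)` becomes the upper right one
    (fun j => if Even j then q * MvPolynomial.C (star (extendZero c j))
      else MvPolynomial.C (extendZero c j))
    (fun j => if Even j then MvPolynomial.C (extendZero c j)
      else q * MvPolynomial.C (star (extendZero c j))),
    ← Matrix.det_submatrix_equiv_self (evenOdd n),
    triMat_submatrix_evenOdd (MvPolynomial.C : ℂ →+* MvPolynomial (Fin 3) ℂ) n c,
    det_fromBlocks_smul_one (by omega) _ _ (linePoly_ne_zero α)]
  · congr 1
    simp only [← linePoly_mul_linePoly_sub, ← hq]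
    refine MvPolynomial.funext fun x => ?_
    rw [RingHom.map_det, map_prod]
    have h : (MvPolynomial.eval x).mapMatrix
        ((linePoly α * linePoly β) • (1 : Matrix (Fin (n / 2)) (Fin (n / 2)) _) -
          HMul.hMul (q • (bidiag n c)ᴴ.map (MvPolynomial.C : ℂ →+* MvPolynomial (Fin 3) ℂ))
            ((bidiag n c).map (MvPolynomial.C : ℂ →+* MvPolynomial (Fin 3) ℂ))) =
        (MvPolynomial.eval x (linePoly α * linePoly β)) •
            (1 : Matrix (Fin (n / 2)) (Fin (n / 2)) ℂ) -
          MvPolynomial.eval x q • ((bidiag n c)ᴴ * bidiag n c) := by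
      ext i j
      simp only [RingHom.mapMatrix_apply, Matrix.map_apply, Matrix.sub_apply, Matrix.smul_apply,
        smul_eq_mul, map_sub, map_mul, Matrix.mul_apply, map_sum, MvPolynomial.eval_C,
        Finset.mul_sum, Matrix.one_apply]
      congr 1
      · split_ifs <;> simp
      · exact Finset.sum_congr rfl fun a _ => by ring
    rw [h, det_smul_one_sub_smul_conjTranspose_mul_self]
    refine Finset.prod_congr rfl fun j _ => ?_
    rw [map_sub, map_mul (MvPolynomial.eval x) q, MvPolynomial.eval_C]
    rfl
  · intro j
    simp only [RCLike.star_def]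
    split_ifs <;> ring

/-- The points of contact with their envelope of the lines that are nonsingular points of the curve
`G = 0` in line coordinates. -/
def contactSet (G : MvPolynomial (Fin 3) ℂ) : Set (ℂ × ℂ) :=
  {P | ∃ l : Fin 3 → ℂ, l ≠ 0 ∧ MvPolynomial.eval l G = 0 ∧
      ∃ t : ℂ, t ≠ 0 ∧
        MvPolynomial.eval l (MvPolynomial.pderiv 0 G) = t * P.1 ∧
        MvPolynomial.eval l (MvPolynomial.pderiv 1 G) = t * P.2 ∧
        MvPolynomial.eval l (MvPolynomial.pderiv 2 G) = t}

/-- `G = 0` has no singular points. -/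
def IsSmoothForm (G : MvPolynomial (Fin 3) ℂ) : Prop :=
  ∀ l : Fin 3 → ℂ, l ≠ 0 → MvPolynomial.eval l G = 0 →
    ∃ i, MvPolynomial.eval l (MvPolynomial.pderiv i G) ≠ 0

theorem dualCurve_eq (F : MvPolynomial (Fin 3) ℂ) :
    dualCurve F = closure (⋃ p ∈ {p | Irreducible p ∧ p ∣ F}, contactSet p) := by
  rw [dualCurve]
  congr 1
  ext P
  simp only [Set.mem_iUnion, exists_prop, contactSet, Set.mem_ofPred_eq, and_assoc]

theorem eval_pderiv_mul_of_eval_eq_zero {p h : MvPolynomial (Fin 3) ℂ} {l : Fin 3 → ℂ}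
    (hp : MvPolynomial.eval l p = 0) (i : Fin 3) :
    MvPolynomial.eval l (MvPolynomial.pderiv i (p * h)) =
      MvPolynomial.eval l h * MvPolynomial.eval l (MvPolynomial.pderiv i p) := by
  rw [MvPolynomial.pderiv_mul, map_add, map_mul, map_mul, hp]
  ring

/-- At a nonsingular point of `G = p h` on `p = 0` the cofactor `h` does not vanish, so that `p` and
`G` have the same point of contact there. -/
theorem contactSet_subset_of_dvd {p G : MvPolynomial (Fin 3) ℂ} (hG : IsSmoothForm G) (hp : p ∣ G) :
    contactSet p ⊆ contactSet G := by
  obtain ⟨h, rfl⟩ := hp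
  rintro P ⟨l, hl, hpl, t, ht, h0, h1, h2⟩
  have hpl' : MvPolynomial.eval l (p * h) = 0 := by rw [map_mul, hpl, zero_mul]
  obtain ⟨i, hi⟩ := hG l hl hpl'
  rw [eval_pderiv_mul_of_eval_eq_zero hpl] at hi
  refine ⟨l, hl, hpl', MvPolynomial.eval l h * t, mul_ne_zero (left_ne_zero_of_mul hi) ht, ?_, ?_,
    ?_⟩
  · rw [eval_pderiv_mul_of_eval_eq_zero hpl, h0, mul_assoc]
  · rw [eval_pderiv_mul_of_eval_eq_zero hpl, h1, mul_assoc]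
  · rw [eval_pderiv_mul_of_eval_eq_zero hpl, h2]

/-- A point of contact of `G` is a point of contact of an irreducible factor of `G`. -/
theorem exists_irreducible_mem_contactSet {G : MvPolynomial (Fin 3) ℂ} {P : ℂ × ℂ}
    (hP : P ∈ contactSet G) : ∃ p, Irreducible p ∧ p ∣ G ∧ P ∈ contactSet p := by
  obtain ⟨l, hl, hGl, t, ht, h0, h1, h2⟩ := hP
  have hG : G ≠ 0 := by
    rintro rfl
    rw [map_zero, map_zero] at h2
    exact ht h2.symm
  obtain ⟨f, hf, hfG⟩ := WfDvdMonoid.exists_factors G hG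
  obtain ⟨p, hpf, hpl⟩ : ∃ p ∈ f, MvPolynomial.eval l p = 0 := by
    have h3 : MvPolynomial.eval l f.prod = 0 := by
      obtain ⟨u, hu⟩ := hfG.symm
      rw [← hu, map_mul, hGl, zero_mul]
    rw [map_multiset_prod, Multiset.prod_eq_zero_iff, Multiset.mem_map] at h3
    exact h3
  obtain ⟨h, rfl⟩ : p ∣ G := (Multiset.dvd_prod hpf).trans hfG.dvd
  have ht' := h2
  rw [eval_pderiv_mul_of_eval_eq_zero hpl] at h0 h1 h2
  have hh : MvPolynomial.eval l h ≠ 0 := fun h3 => by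
    rw [h3, zero_mul] at h2
    exact ht h2.symm
  refine ⟨p, hf p hpf, dvd_mul_right _ _, l, hl, hpl, t / MvPolynomial.eval l h,
    div_ne_zero ht hh, ?_, ?_, ?_⟩
  · field_simp; rw [mul_comm, h0]
  · field_simp; rw [mul_comm, h1]
  · field_simp; rw [mul_comm, h2]

theorem eval_linePoly (z : ℂ) (l : Fin 3 → ℂ) :
    MvPolynomial.eval l (linePoly z) = l 0 * z.re + l 1 * z.im + l 2 := by
  simp [linePoly]

theorem pderiv_linePoly (z : ℂ) : MvPolynomial.pderiv 0 (linePoly z) = MvPolynomial.C (z.re : ℂ) ∧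
    MvPolynomial.pderiv 1 (linePoly z) = MvPolynomial.C (z.im : ℂ) ∧
    MvPolynomial.pderiv 2 (linePoly z) = 1 := by
  simp [linePoly, MvPolynomial.pderiv_X]

theorem isSmoothForm_linePoly (z : ℂ) : IsSmoothForm (linePoly z) := fun l _ _ =>
  ⟨2, by rw [(pderiv_linePoly z).2.2]; simp⟩

theorem contactSet_linePoly (z : ℂ) : contactSet (linePoly z) = {((z.re : ℂ), (z.im : ℂ))} := by
  obtain ⟨h0, h1, h2⟩ := pderiv_linePoly z
  ext ⟨x, y⟩
  simp only [contactSet, Set.mem_ofPred_eq, h0, h1, h2, MvPolynomial.eval_C, map_one,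
    Set.mem_singleton_iff, Prod.mk.injEq]
  constructor
  · rintro ⟨l, -, -, t, -, hx, hy, ht⟩
    rw [← ht, one_mul] at hx hy
    exact ⟨hx.symm, hy.symm⟩
  · rintro ⟨rfl, rfl⟩
    refine ⟨![1, 0, -z.re], fun h => ?_, ?_, 1, one_ne_zero, by simp, by simp, rfl⟩
    · simpa using congrFun h 0
    · rw [eval_linePoly]; simp

theorem eval_conicPoly (m F : ℂ) (h : ℝ) (l : Fin 3 → ℂ) :
    MvPolynomial.eval l (conicPoly m F h) = (l 0 * m.re + l 1 * m.im + l 2) ^ 2 -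
      ((h + F.re) / 2 * l 0 ^ 2 + F.im * l 0 * l 1 + (h - F.re) / 2 * l 1 ^ 2) := by
  simp [conicPoly, linePoly]

theorem eval_pderiv_conicPoly (m F : ℂ) (h : ℝ) (l : Fin 3 → ℂ) :
    MvPolynomial.eval l (MvPolynomial.pderiv 0 (conicPoly m F h)) =
        2 * (l 0 * m.re + l 1 * m.im + l 2) * m.re - ((h + F.re) * l 0 + F.im * l 1) ∧
    MvPolynomial.eval l (MvPolynomial.pderiv 1 (conicPoly m F h)) =
        2 * (l 0 * m.re + l 1 * m.im + l 2) * m.im - (F.im * l 0 + (h - F.re) * l 1) ∧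
    MvPolynomial.eval l (MvPolynomial.pderiv 2 (conicPoly m F h)) =
        2 * (l 0 * m.re + l 1 * m.im + l 2) := by
  refine ⟨?_, ?_, ?_⟩ <;>
    simp [conicPoly, linePoly, MvPolynomial.pderiv_X, pow_two] <;> ring

theorem isSmoothForm_conicPoly (m F : ℂ) (h : ℝ) (hF : h ^ 2 - (F.re ^ 2 + F.im ^ 2) ≠ 0) :
    IsSmoothForm (conicPoly m F h) := by
  intro l hl _
  by_contra! hall
  obtain ⟨e0, e1, e2⟩ := eval_pderiv_conicPoly m F h l
  have h0 := e0.symm.trans (hall 0)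
  have h1 := e1.symm.trans (hall 1)
  have h2 := e2.symm.trans (hall 2)
  have hFc : ((h : ℂ) ^ 2 - ((F.re : ℂ) ^ 2 + (F.im : ℂ) ^ 2)) ≠ 0 := by exact_mod_cast hF
  rw [h2, zero_mul, zero_sub, neg_eq_zero] at h0 h1
  have hu : l 0 = 0 := by
    refine (mul_eq_zero.mp ?_).resolve_left hFc
    linear_combination ((h : ℂ) - F.re) * h0 - F.im * h1
  have hv : l 1 = 0 := by
    refine (mul_eq_zero.mp ?_).resolve_left hFc
    linear_combination ((h : ℂ) + F.re) * h1 - F.im * h0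
  have hw : l 2 = 0 := by
    rw [hu, hv] at h2
    linear_combination h2 / 2
  refine hl (funext fun i => ?_)
  fin_cases i
  · exact hu
  · exact hv
  · exact hw

/-- The dual of a nondegenerate conic is the conic given by the adjugate matrix. -/
theorem contactSet_conicPoly (m F : ℂ) (h : ℝ) (hF : h ^ 2 - (F.re ^ 2 + F.im ^ 2) ≠ 0) :
    contactSet (conicPoly m F h) = {P | (h - F.re) * (P.1 - m.re) ^ 2 -
      2 * F.im * (P.1 - m.re) * (P.2 - m.im) + (h + F.re) * (P.2 - m.im) ^ 2 =
        ((h : ℂ) ^ 2 - ((F.re : ℂ) ^ 2 + (F.im : ℂ) ^ 2)) / 2} := by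
  have hFc : ((h : ℂ) ^ 2 - ((F.re : ℂ) ^ 2 + (F.im : ℂ) ^ 2)) ≠ 0 := by exact_mod_cast hF
  ext ⟨x, y⟩
  constructor
  · rintro ⟨l, hl, hl0, t, ht, h0, h1, h2⟩
    obtain ⟨e0, e1, e2⟩ := eval_pderiv_conicPoly m F h l
    rw [e0] at h0
    rw [e1] at h1
    rw [e2] at h2
    rw [eval_conicPoly] at hl0
    simp only at h0 h1
    rw [h2] at h0 h1
    have hX : t * (x - m.re) = -((h + F.re) * l 0 + F.im * l 1) := by linear_combination -h0
    have hY : t * (y - m.im) = -(F.im * l 0 + (h - F.re) * l 1) := by linear_combination -h1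
    refine mul_left_cancel₀ (pow_ne_zero 2 ht) ?_
    simp only
    have e : t ^ 2 * ((h - F.re) * (x - m.re) ^ 2 -
        2 * F.im * (x - m.re) * (y - m.im) + (h + F.re) * (y - m.im) ^ 2) =
        (h - F.re) * (t * (x - m.re)) ^ 2 - 2 * F.im * (t * (x - m.re)) * (t * (y - m.im)) +
          (h + F.re) * (t * (y - m.im)) ^ 2 := by ring
    rw [e, hX, hY, ← h2]
    linear_combination (-2 * ((h : ℂ) ^ 2 - ((F.re : ℂ) ^ 2 + (F.im : ℂ) ^ 2))) * hl0
  · intro hP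
    simp only [Set.mem_ofPred_eq] at hP
    set D := ((h : ℂ) ^ 2 - ((F.re : ℂ) ^ 2 + (F.im : ℂ) ^ 2)) with hD
    set X := x - m.re with hX
    set Y := y - m.im with hY
    -- the polar line of the point, scaled so that the last partial derivative is `1`
    set u := -((h - F.re) * X - F.im * Y) / D with hu
    set v := -(-F.im * X + (h + F.re) * Y) / D with hv
    have hMu : (h + F.re) * u + F.im * v = -X := by
      rw [hu, hv]; field_simp; rw [hD]; ring
    have hMv : F.im * u + (h - F.re) * v = -Y := by
      rw [hu, hv]; field_simp; rw [hD]; ring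
    have hlc : u * m.re + v * m.im + (1 / 2 - u * m.re - v * m.im) = 1 / 2 := by ring
    set l : Fin 3 → ℂ := ![u, v, 1 / 2 - u * m.re - v * m.im] with hl
    have hl0 : l 0 = u := rfl
    have hl1 : l 1 = v := rfl
    have hl2 : l 2 = 1 / 2 - u * m.re - v * m.im := rfl
    obtain ⟨e0, e1, e2⟩ := eval_pderiv_conicPoly m F h l
    rw [hl0, hl1, hl2, hlc] at e0 e1 e2
    have hquad : u * X + v * Y = -1 / 2 := by
      have : u * X + v * Y = -((h - F.re) * X ^ 2 - 2 * F.im * X * Y + (h + F.re) * Y ^ 2) / D := by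
        rw [hu, hv]; field_simp; ring
      rw [this, hP]; field_simp
    refine ⟨l, fun hzero => ?_, ?_, 1, one_ne_zero, ?_, ?_, ?_⟩
    · have z0 : u = 0 := congrFun hzero 0
      have z1 : v = 0 := congrFun hzero 1
      rw [z0, z1] at hquad
      norm_num at hquad
    · rw [eval_conicPoly, hl0, hl1, hl2, hlc]
      linear_combination (-1 / 2 * u) * hMu + (-1 / 2 * v) * hMv + hquad / 2
    · rw [e0, hMu, hX]; ring
    · rw [e1, hMv, hY]; ring
    · rw [e2]; norm_num

theorem isClosed_contactSet_conicPoly (m F : ℂ) (h : ℝ) (hF : h ^ 2 - (F.re ^ 2 + F.im ^ 2) ≠ 0) :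
    IsClosed (contactSet (conicPoly m F h)) := by
  rw [contactSet_conicPoly m F h hF]
  exact isClosed_eq (by fun_prop) continuous_const

theorem mem_contactSet_conicPoly_iff (m F : ℂ) (h : ℝ) (hF : h ^ 2 - (F.re ^ 2 + F.im ^ 2) ≠ 0)
    (z : ℂ) : ((z.re : ℂ), (z.im : ℂ)) ∈ contactSet (conicPoly m F h) ↔
      hypForm F h (z - m) = (‖F‖ ^ 2 - h ^ 2) / 2 := by
  rw [contactSet_conicPoly m F h hF, Set.mem_ofPred_eq]
  simp only
  have e : (h - F.re) * (z.re - m.re) ^ 2 - 2 * F.im * (z.re - m.re) * (z.im - m.im) +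
      (h + F.re) * (z.im - m.im) ^ 2 = -hypForm F h (z - m) := by
    simp only [hypForm, Complex.sq_norm, Complex.normSq_apply]
    simp only [Complex.mul_re, Complex.conj_re, Complex.conj_im, Complex.sub_re, Complex.sub_im, sq,
      Complex.mul_im]
    ring
  have e2 : ‖F‖ ^ 2 = F.re ^ 2 + F.im ^ 2 := by
    rw [Complex.sq_norm, Complex.normSq_apply]; ring
  rw [e2]
  constructor
  · intro h1
    have h2 : (h - F.re) * (z.re - m.re) ^ 2 - 2 * F.im * (z.re - m.re) * (z.im - m.im) +
      (h + F.re) * (z.im - m.im) ^ 2 = (h ^ 2 - (F.re ^ 2 + F.im ^ 2)) / 2 := by exact_mod_cast h1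
    linarith
  · intro h1
    have h2 : (h - F.re) * (z.re - m.re) ^ 2 - 2 * F.im * (z.re - m.re) * (z.im - m.im) +
      (h + F.re) * (z.im - m.im) ^ 2 = (h ^ 2 - (F.re ^ 2 + F.im ^ 2)) / 2 := by linarith
    exact_mod_cast h2

/-! ### Assembling the curve and the range -/

theorem bidiagSing_pos_iff {n : ℕ} (c : Fin (n - 1) → ℂ) (j : ℕ) :
    0 < bidiagSing n c j ↔ j < (bidiag n c).rank := by
  rw [bidiagSing, LinearMap.singularValues_pos_iff_lt_finrank_range,
    Matrix.rank_eq_finrank_range_toLin _ (EuclideanSpace.basisFun _ ℂ).toBasis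
      (EuclideanSpace.basisFun _ ℂ).toBasis, Matrix.toEuclideanLin_eq_toLin_orthonormal]

theorem bidiag_rank_pos {n : ℕ} (c : Fin (n - 1) → ℂ) (hc : c ≠ 0) : 0 < (bidiag n c).rank := by
  rw [Nat.pos_iff_ne_zero]
  intro h0
  have h : bidiag n c = 0 := by
    rw [Matrix.rank, Submodule.finrank_eq_zero, LinearMap.range_eq_bot] at h0
    ext i j
    simpa using congrFun (LinearMap.congr_fun h0 (Pi.single j 1)) i
  refine hc (funext fun j => ?_)
  rcases Nat.even_or_odd' j with ⟨a, ha | ha⟩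
  · have h1 := congrFun (congrFun h ⟨a, by omega⟩) ⟨a, by omega⟩
    rw [bidiag_apply, if_pos rfl, extendZero_of_lt _ (by simp only; omega)] at h1
    exact (congrArg c (Fin.ext ha)).trans h1
  · have h1 := congrFun (congrFun h ⟨a + 1, by omega⟩) ⟨a, by omega⟩
    rw [bidiag_apply, if_neg (by simp), if_pos rfl, extendZero_of_lt _ (by simp only; omega)] at h1
    exact (congrArg c (Fin.ext ha)).trans h1

/-- At `s = 0` the hyperbola degenerates into the pair of points `α`, `β`. -/
theorem conicPoly_zero (α β κ : ℂ) :
    conicPoly ((α + β) / 2) (focalSq ((α - β) / 2) κ 0) (axisDiff ((α - β) / 2) κ 0) =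
      linePoly α * linePoly β := by
  rw [← linePoly_mul_linePoly_sub]
  simp

/-- The dual curve of a product of `A ^ e`, of nonsingular forms `G_j` for `j < k`, and of a factor
`G_j = A B` for each `k ≤ j < N`. -/
theorem dualCurve_mul_prod (A B : MvPolynomial (Fin 3) ℂ) (G : ℕ → MvPolynomial (Fin 3) ℂ)
    (e k N : ℕ) (hkN : k ≤ N) (hA : IsSmoothForm A) (hB : IsSmoothForm B)
    (hG : ∀ j < k, IsSmoothForm (G j)) (hG0 : ∀ j, k ≤ j → j < N → G j = A * B)
    (hAc : IsClosed (contactSet A)) (hBc : IsClosed (contactSet B))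
    (hGc : ∀ j < k, IsClosed (contactSet (G j))) :
    dualCurve (A ^ e * ∏ j ∈ Finset.range N, G j) =
      (⋃ j : Fin k, contactSet (G j)) ∪
        (if k < N then contactSet A ∪ contactSet B else if e ≠ 0 then contactSet A else ∅) := by
  have hdvdG : ∀ j < N, G j ∣ A ^ e * ∏ j ∈ Finset.range N, G j := fun j hj =>
    (Finset.dvd_prod_of_mem G (Finset.mem_range.mpr hj)).trans (dvd_mul_left _ _)
  rw [dualCurve_eq]
  have hclosed : IsClosed ((⋃ j : Fin k, contactSet (G j)) ∪
      (if k < N then contactSet A ∪ contactSet B else if e ≠ 0 then contactSet A else ∅)) := by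
    refine (isClosed_iUnion_of_finite fun j : Fin k => hGc j j.2).union ?_
    split_ifs
    · exact hAc.union hBc
    · exact hAc
    · exact isClosed_empty
  rw [← hclosed.closure_eq]
  congr 1
  ext P
  constructor
  · intro hP
    simp only [Set.mem_iUnion, exists_prop, Set.mem_ofPred_eq] at hP
    obtain ⟨p, ⟨hp, hpF⟩, hP⟩ := hP
    rcases hp.prime.dvd_or_dvd hpF with h | h
    · have he : e ≠ 0 := by
        rintro rfl
        rw [pow_zero] at h
        exact hp.not_isUnit (isUnit_of_dvd_one h)
      have hPA := contactSet_subset_of_dvd hA (hp.prime.dvd_of_dvd_pow h) hP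
      right
      split_ifs with h1
      · exact Or.inl hPA
      · exact hPA
    · obtain ⟨j, hj, hpj⟩ := (Prime.dvd_finsetProd_iff hp.prime G).mp h
      rw [Finset.mem_range] at hj
      by_cases hjk : j < k
      · left
        exact Set.mem_iUnion.mpr ⟨⟨j, hjk⟩, contactSet_subset_of_dvd (hG j hjk) hpj hP⟩
      · right
        rw [if_pos (by omega)]
        rw [hG0 j (by omega) hj] at hpj
        rcases hp.prime.dvd_or_dvd hpj with h1 | h1
        · exact Or.inl (contactSet_subset_of_dvd hA h1 hP)
        · exact Or.inr (contactSet_subset_of_dvd hB h1 hP)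
  · have main : ∀ H, H ∣ A ^ e * ∏ j ∈ Finset.range N, G j → P ∈ contactSet H →
        P ∈ ⋃ p ∈ {p | Irreducible p ∧ p ∣ A ^ e * ∏ j ∈ Finset.range N, G j}, contactSet p := by
      intro H hH hPH
      obtain ⟨p, hp, hpH, hPp⟩ := exists_irreducible_mem_contactSet hPH
      simp only [Set.mem_iUnion, exists_prop, Set.mem_ofPred_eq]
      exact ⟨p, ⟨hp, hpH.trans hH⟩, hPp⟩
    rintro (hP | hP)
    · obtain ⟨j, hj⟩ := Set.mem_iUnion.mp hP
      exact main _ (hdvdG j (j.2.trans_le hkN)) hj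
    · split_ifs at hP with h1 h2
      · have hAB : A * B ∣ A ^ e * ∏ j ∈ Finset.range N, G j := by
          rw [← hG0 k le_rfl h1]
          exact hdvdG k h1
        rcases hP with hP | hP
        · exact main _ ((dvd_mul_right _ _).trans hAB) hP
        · exact main _ ((dvd_mul_left _ _).trans hAB) hP
      · exact main _ ((dvd_pow_self A h2).trans (dvd_mul_right _ _)) hP
      · exact hP.elim

theorem kreinCurve_biperiodicTridiag {n : ℕ} (α β κ : ℂ) (c d : Fin (n - 1) → ℂ)
    (hd : ∀ j, d j = κ * star (c j))
    (hF : ∀ j < (bidiag n c).rank, |axisDiff ((α - β) / 2) κ (bidiagSing n c j)| <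
      ‖focalSq ((α - β) / 2) κ (bidiagSing n c j)‖) :
    kreinCurve (altSign n) (biperiodicTridiag n α β c d) =
      (⋃ j : Fin (bidiag n c).rank, {z | hypForm (focalSq ((α - β) / 2) κ (bidiagSing n c j))
        (axisDiff ((α - β) / 2) κ (bidiagSing n c j)) (z - (α + β) / 2) =
          (‖focalSq ((α - β) / 2) κ (bidiagSing n c j)‖ ^ 2 -
            axisDiff ((α - β) / 2) κ (bidiagSing n c j) ^ 2) / 2}) ∪
        exceptionalPoints n (bidiag n c).rank α β := by
  have hdet : ∀ j < (bidiag n c).rank, axisDiff ((α - β) / 2) κ (bidiagSing n c j) ^ 2 -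
      ((focalSq ((α - β) / 2) κ (bidiagSing n c j)).re ^ 2 +
        (focalSq ((α - β) / 2) κ (bidiagSing n c j)).im ^ 2) ≠ 0 := by
    intro j hj
    have h1 := hF j hj
    rw [← abs_of_nonneg (norm_nonneg (focalSq _ _ _)), ← sq_lt_sq, Complex.sq_norm,
      Complex.normSq_apply] at h1
    nlinarith
  have hpt : ∀ z w : ℂ, ((z.re : ℂ), (z.im : ℂ)) ∈ contactSet (linePoly w) ↔ z = w := by
    intro z w
    rw [contactSet_linePoly, Set.mem_singleton_iff, Prod.mk.injEq, Complex.ofReal_inj,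
      Complex.ofReal_inj, Complex.ext_iff]
  rw [kreinCurve, kreinForm_biperiodicTridiag α β κ c d hd,
    dualCurve_mul_prod (linePoly α) (linePoly β) _ _ (bidiag n c).rank (n / 2)
      (Matrix.rank_le_width _) (isSmoothForm_linePoly α) (isSmoothForm_linePoly β)
      (fun j hj => isSmoothForm_conicPoly _ _ _ (hdet j hj)) ?_
      (by rw [contactSet_linePoly]; exact isClosed_singleton)
      (by rw [contactSet_linePoly]; exact isClosed_singleton)
      (fun j hj => isClosed_contactSet_conicPoly _ _ _ (hdet j hj))]
  · ext z
    simp only [Set.mem_ofPred_eq, Set.mem_union, Set.mem_iUnion]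
    refine or_congr (exists_congr fun j => mem_contactSet_conicPoly_iff _ _ _ (hdet j j.2) z) ?_
    have hodd : (n + 1) / 2 - n / 2 ≠ 0 ↔ Odd n := by rw [Nat.odd_iff]; omega
    rw [exceptionalPoints]
    simp only [hodd]
    split_ifs
    · simp only [Set.mem_union, hpt, Set.mem_insert_iff, Set.mem_singleton_iff]
    · simp only [hpt, Set.mem_singleton_iff]
    · simp only [Set.mem_empty_iff_false]
  · intro j hj _
    have h0 : bidiagSing n c j = 0 := le_antisymm
      (not_lt.mp fun h => absurd ((bidiagSing_pos_iff c j).mp h) (by omega))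
      (LinearMap.singularValues_nonneg _ _)
    rw [h0, conicPoly_zero]

theorem isHyperbolaData_focus_iff (α β κ : ℂ) (s : ℝ) :
    IsHyperbolaData (focusPlus α β κ s) (focusMinus α β κ s) (nonTransverseAxis α β κ s) ↔
      |axisDiff ((α - β) / 2) κ s| < ‖focalSq ((α - β) / 2) κ s‖ :=
  isHyperbolaData_iff (sq_cpow_half _) (nonTransverseAxis_eq α β κ s)

theorem mem_hyperbolicDisc_focus_iff (α β κ : ℂ) (s : ℝ)
    (h : |axisDiff ((α - β) / 2) κ s| < ‖focalSq ((α - β) / 2) κ s‖) (z : ℂ) :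
    z ∈ hyperbolicDisc (focusPlus α β κ s) (focusMinus α β κ s) (nonTransverseAxis α β κ s) ↔
      (‖focalSq ((α - β) / 2) κ s‖ ^ 2 - axisDiff ((α - β) / 2) κ s ^ 2) / 2 ≤
        hypForm (focalSq ((α - β) / 2) κ s) (axisDiff ((α - β) / 2) κ s) (z - (α + β) / 2) :=
  mem_hyperbolicDisc_iff (sq_cpow_half _) (nonTransverseAxis_eq α β κ s) h z

theorem mem_hyperbola_focus_iff (α β κ : ℂ) (s : ℝ)
    (h : |axisDiff ((α - β) / 2) κ s| < ‖focalSq ((α - β) / 2) κ s‖) (z : ℂ) :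
    z ∈ hyperbola (focusPlus α β κ s) (focusMinus α β κ s) (nonTransverseAxis α β κ s) ↔
      hypForm (focalSq ((α - β) / 2) κ s) (axisDiff ((α - β) / 2) κ s) (z - (α + β) / 2) =
        (‖focalSq ((α - β) / 2) κ s‖ ^ 2 - axisDiff ((α - β) / 2) κ s ^ 2) / 2 :=
  mem_hyperbola_iff (sq_cpow_half _) (nonTransverseAxis_eq α β κ s) h z

theorem hyperbolicDisc_eq_hyperboloidImage (α β κ : ℂ) (s : ℝ)
    (h : |axisDiff ((α - β) / 2) κ s| < ‖focalSq ((α - β) / 2) κ s‖) :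
    hyperbolicDisc (focusPlus α β κ s) (focusMinus α β κ s) (nonTransverseAxis α β κ s) =
      hyperboloidImage α β κ s := by
  ext z
  rw [mem_hyperbolicDisc_focus_iff α β κ s h]
  constructor
  · intro hz
    obtain ⟨t, y, hty, hzy⟩ := exists_hyperboloid_of_hypForm_ge _ κ _ s h hz
    exact ⟨t, y, hty.ge, by linear_combination hzy⟩
  · rintro ⟨t, y, hty, rfl⟩
    have := hypForm_ge_of_hyperboloid ((α - β) / 2) κ y s t h hty
    rw [add_assoc, add_sub_cancel_left]
    exact this

theorem kreinRange_eq_hyperbolicDisc {n : ℕ} (hn : 2 ≤ n) (α β κ : ℂ) (c d : Fin (n - 1) → ℂ)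
    (hd : ∀ j, d j = κ * star (c j)) (hs : 0 < bidiagSing n c 0)
    (h : |axisDiff ((α - β) / 2) κ (bidiagSing n c 0)| <
      ‖focalSq ((α - β) / 2) κ (bidiagSing n c 0)‖) :
    kreinRange (altSign n) (biperiodicTridiag n α β c d) =
      hyperbolicDisc (focusPlus α β κ (bidiagSing n c 0)) (focusMinus α β κ (bidiagSing n c 0))
        (nonTransverseAxis α β κ (bidiagSing n c 0)) := by
  refine Set.Subset.antisymm ?_ fun z hz => ?_
  · rw [hyperbolicDisc_eq_hyperboloidImage _ _ _ _ h]
    exact kreinRange_subset_hyperboloidImage α β κ c d hd hs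
  · rw [mem_hyperbolicDisc_focus_iff α β κ _ h] at hz
    obtain ⟨t, y, hty, hzy⟩ := exists_hyperboloid_of_hypForm_ge _ κ _ _ h hz
    have hz' := mem_kreinRange_of_hyperboloid hn α β κ c d hd hs t y hty
    convert! hz' using 1
    linear_combination hzy

theorem frontier_hyperbolicDisc (α β κ : ℂ) (s : ℝ)
    (h : |axisDiff ((α - β) / 2) κ s| < ‖focalSq ((α - β) / 2) κ s‖) :
    frontier (hyperbolicDisc (focusPlus α β κ s) (focusMinus α β κ s)
      (nonTransverseAxis α β κ s)) =
      hyperbola (focusPlus α β κ s) (focusMinus α β κ s) (nonTransverseAxis α β κ s) := by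
  have h1 : hyperbolicDisc (focusPlus α β κ s) (focusMinus α β κ s) (nonTransverseAxis α β κ s) =
      {z | (‖focalSq ((α - β) / 2) κ s‖ ^ 2 - axisDiff ((α - β) / 2) κ s ^ 2) / 2 ≤
        hypForm (focalSq ((α - β) / 2) κ s) (axisDiff ((α - β) / 2) κ s) (z - (α + β) / 2)} :=
    Set.ext fun z => mem_hyperbolicDisc_focus_iff α β κ s h z
  rw [h1, frontier_superlevel_hypForm]
  · exact Set.ext fun z => (mem_hyperbola_focus_iff α β κ s h z).symm
  · have h2 : axisDiff ((α - β) / 2) κ s ^ 2 < ‖focalSq ((α - β) / 2) κ s‖ ^ 2 := by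
      rw [sq_lt_sq, abs_of_nonneg (norm_nonneg _)]; exact h
    linarith

theorem mainTheorem9 (n : ℕ) (α β κ : ℂ) (c d : Fin (n - 1) → ℂ) (hc : c ≠ 0)
    (hd : ∀ j, d j = κ * star (c j))
    (T : Matrix (Fin n) (Fin n) ℂ) (hT : T = biperiodicTridiag n α β c d)
    (s : ℕ → ℝ) (hs : ∀ j, s j = bidiagSing n c j)
    (k : ℕ) (hk : k = (bidiag n c).rank)
    (f₁ f₂ : ℕ → ℂ) (hf₁ : ∀ j, f₁ j = focusPlus α β κ (s j))
    (hf₂ : ∀ j, f₂ j = focusMinus α β κ (s j))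
    (b : ℕ → ℝ) (hb : ∀ j, b j = nonTransverseAxis α β κ (s j)) :
    (((∀ j < k, IsHyperbolaData (f₁ j) (f₂ j) (b j)) ∧
        (∀ i j, i ≤ j → j < k →
          hyperbolicDisc (f₁ j) (f₂ j) (b j) ⊆ hyperbolicDisc (f₁ i) (f₂ i) (b i)) ∧
        kreinCurve (altSign n) T =
          (⋃ j : Fin k, hyperbola (f₁ j) (f₂ j) (b j)) ∪ exceptionalPoints n k α β) ↔
      |‖(α - β) / 2‖ ^ 2 - (‖κ‖ ^ 2 + 1) / 2 * s 0 ^ 2| <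
        ‖((α - β) / 2) ^ 2 + κ * (s 0 : ℂ) ^ 2‖) ∧
    (|‖(α - β) / 2‖ ^ 2 - (‖κ‖ ^ 2 + 1) / 2 * s 0 ^ 2| <
        ‖((α - β) / 2) ^ 2 + κ * (s 0 : ℂ) ^ 2‖ →
      IsHyperbolaData (f₁ 0) (f₂ 0) (b 0) ∧
      kreinRange (altSign n) T = hyperbolicDisc (f₁ 0) (f₂ 0) (b 0) ∧
      frontier (kreinRange (altSign n) T) = hyperbola (f₁ 0) (f₂ 0) (b 0)) := by
  subst hT
  obtain rfl : s = bidiagSing n c := funext hs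
  obtain rfl : f₁ = fun j => focusPlus α β κ (bidiagSing n c j) := funext hf₁
  obtain rfl : f₂ = fun j => focusMinus α β κ (bidiagSing n c j) := funext hf₂
  obtain rfl : b = fun j => nonTransverseAxis α β κ (bidiagSing n c j) := funext hb
  subst hk
  have hk := bidiag_rank_pos c hc
  have hn : 2 ≤ n := by
    have := (bidiag n c).rank_le_width
    omega
  have hs0 : 0 < bidiagSing n c 0 := (bidiagSing_pos_iff c 0).mpr hk
  refine ⟨⟨fun h => (isHyperbolaData_focus_iff α β κ _).mp (h.1 0 hk), fun h => ?_⟩, fun h => ?_⟩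
  · have hF : ∀ j < (bidiag n c).rank, |axisDiff ((α - β) / 2) κ (bidiagSing n c j)| <
        ‖focalSq ((α - β) / 2) κ (bidiagSing n c j)‖ := fun j hj =>
      abs_axisDiff_lt_of_le _ κ ((bidiagSing_pos_iff c j).mpr hj)
        (LinearMap.singularValues_antitone _ (Nat.zero_le j)) h
    refine ⟨fun j hj => (isHyperbolaData_focus_iff α β κ _).mpr (hF j hj), fun i j hij hj => ?_, ?_⟩
    · simp only
      rw [hyperbolicDisc_eq_hyperboloidImage _ _ _ _ (hF j hj),
        hyperbolicDisc_eq_hyperboloidImage _ _ _ _ (hF i (hij.trans_lt hj))]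
      exact hyperboloidImage_mono α β κ ((bidiagSing_pos_iff c j).mpr hj)
        (LinearMap.singularValues_antitone _ hij)
    · rw [kreinCurve_biperiodicTridiag α β κ c d hd hF]
      congr 1
      refine Set.iUnion_congr fun j => Set.ext fun z => ?_
      exact (mem_hyperbola_focus_iff α β κ _ (hF j j.2) z).symm
  · refine ⟨(isHyperbolaData_focus_iff α β κ _).mpr h,
      kreinRange_eq_hyperbolicDisc hn α β κ c d hd hs0 h, ?_⟩
    rw [kreinRange_eq_hyperbolicDisc hn α β κ c d hd hs0 h]
    exact frontier_hyperbolicDisc α β κ _ h
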